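/- Notation. For real $q$ with $q\neq0$, $|q|\ne1$ put $(q;q)_k=\prod_{i=1}^k(1-q^i)$, and for natural numbers $k$ $$\Gamma_q(k+1)=\frac{(q;q)_k}{(1-q)^k},\qquad G_q(k+1)=\prod_{i=1}^{k-1}\Gamma_q(i+1),\qquad G(k+1)=\prod_{i=1}^{k-1}\Gamma(i+1)$$ (the $q$-Gamma, $q$-Barnes and Barnes functions at positive integers). For $n\in\mathbb Z$, $m\in\mathbb N$ let ${n\brack m}_q=\prod_{i=1}^m\frac{1-q^{n-m+i}}{1-q^i}$, so that ${n\brack m}_q=\frac{\Gamma_q(n+1)}{\Gamma_q(m+1)\Gamma_q(n-m+1)}$ if $n\ge m$, and let $\binom nm=\prod_{i=1}^m\frac{n-m+i}{i}$. $s_{\mu/\lambda}=\det\left(h_{\mu_a-\lambda_b-a+b}\right)_{a,b}$ is the skew Schur polynomial, and $(N^d,j)$ is the partition with $d$ parts $N$ followed by a part $j$. (1) Let $d\ge1$, $0\le j,k\le N$, and $M>d$ (or $M\ge d$, if $j=0$). For every real $q$ with $q\ne0$, $|q|\neq1$, $$s_{(N^d,j)/(k)}(1,q,\dots,q^{M-1})=q^{(d-1)j-dk+d(d-1)N/2}\,G_q(N+2)\frac{G_q(M+N+2)}{G_q(M+1)}\frac{G_q(M-d+1)}{G_q(M-d+N+2)}\frac{G_q(d+1)}{G_q(d+N+2)}$$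 $$\times\sum_{r=\max(j,k)}^{N}q^{r}\,\frac{\Gamma_q(M-d+j+1)\Gamma_q(d+k+1)\Gamma_q(r+1)}{\Gamma_q(j+1)\Gamma_q(k+1)\Gamma_q(M+r+1)}{M-d+r-k-1\brack r-k}_q{d+r-j-1\brack r-j}_q .$$ (2) For the same $N,d,j,k,M$, as $q\to1$ ($q\neq 1$) the right-hand side of (1) converges to $$G(N+2)\frac{G(M+N+2)}{G(M+1)}\frac{G(M-d+1)}{G(M-d+N+2)}\frac{G(d+1)}{G(d+N+2)}\frac{\Gamma(M-d+j+1)}{\Gamma(j+1)}\frac{\Gamma(d+k+1)}{\Gamma(k+1)}\sum_{r=\max(j,k)}^{N}\frac{\Gamma(r+1)}{\Gamma(M+r+1)}\binom{M-d+r-k-1}{r-k}\binom{d+r-j-1}{r-j},$$ and this number equals $s_{(N^d,j)/(k)}(1^M)$. (3) Let $q$ be real with $q\ne0$, $|q|\ne1$, let $\gamma,\delta\ge1$ be integers, and let $\Theta_{\gamma,\delta}(z)=\prod_{i=0}^{\delta-1}(1+q^iz^{-1})\prod_{i=1}^{\gamma}(1+q^iz)$ for $z\neq0$. Let $T_N=(d_{a-b})_{a,b=1}^N$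 be its Toeplitz matrix, where $d_m=\frac1{2\pi}\int_0^{2\pi}\Theta_{\gamma,\delta}(e^{i\theta})e^{-im\theta}d\theta$. Then: (a) $\Theta_{\gamma,\delta}(z)=\sum_{m=-\delta}^{\gamma}{\delta+\gamma\brack\delta+m}_q\,q^{m(m+1)/2}z^m$. (b) For all $N\geq 0$, $\det T_N=G_q(N+1)\frac{G_q(\delta+\gamma+N+1)}{G_q(\delta+\gamma+1)}\frac{G_q(\delta+1)}{G_q(\delta+N+1)}\frac{G_q(\gamma+1)}{G_q(\gamma+N+1)}$. (c) For $n\ge0$ let $c_n=\left(\frac{(q;q)_{\delta+n}(q;q)_{\gamma+n}}{(q;q)_n(q;q)_{\delta+\gamma+n}}\right)^{1/2}$ (principal square root) and $$p_n(z)=c_n\sum_{r=0}^n(-1)^{n+r}{n\brack r}_q\frac{(q;q)_{\gamma+r}}{(q;q)_{\gamma+n}}\frac{(q;q)_{\delta+n-r-1}}{(q;q)_{\delta-1}}z^r,$$ $$q_n(z)=c_n\sum_{r=0}^n(-1)^{n+r}{n\brack r}_q\frac{(q;q)_{\gamma+n-r-1}}{(q;q)_{\gamma-1}}\frac{(q;q)_{\delta+r}}{(q;q)_{\delta+n}}q^{n-r}z^r.$$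 Then $p_n,q_n$ have degree $n$, and $\frac1{2\pi}\int_0^{2\pi}p_m(e^{i\theta})q_n(e^{-i\theta})\Theta_{\gamma,\delta}(e^{i\theta})\,d\theta=\delta_{m,n}$ (Kronecker delta) for all $m,n\ge0$. (d) For all $N\ge0$, $T_{N+1}$ is invertible, and for $0\le j,k\le N$ $$(T_{N+1}^{-1})_{j+1,k+1}=\sum_{r=\max(j,k)}^N(-1)^{j+k}q^{r-k}\frac{\Gamma_q(\gamma+j+1)\Gamma_q(\delta+k+1)\Gamma_q(r+1)}{\Gamma_q(j+1)\Gamma_q(k+1)\Gamma_q(\delta+\gamma+r+1)}{\gamma+r-k-1\brack r-k}_q{\delta+r-j-1\brack r-j}_q .$$ -/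

import Mathlib

open scoped BigOperators Topology

noncomputable section

/-- The finite `q`-Pochhammer product `(q;q)_k = ∏_{i=1}^{k} (1 - q^i)`. -/
def qPoch (q : ℝ) (k : ℕ) : ℝ := ∏ i ∈ Finset.Icc 1 k, (1 - q ^ i)

/-- The `q`-Gamma function at natural arguments: `Γ_q(k+1) = (q;q)_k / (1-q)^k`.
The argument `0` is a pole, where the value is irrelevant (set to `0`). -/
def qGamma (q : ℝ) : ℕ → ℝ
  | 0 => 0
  | k + 1 => qPoch q k / (1 - q) ^ k

/-- The `q`-Barnes function at natural arguments: `G_q(k+1) = ∏_{i=1}^{k-1} Γ_q(i+1)`, `G_q(0) = 0`. -/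
def qBarnes (q : ℝ) : ℕ → ℝ
  | 0 => 0
  | k + 1 => ∏ i ∈ Finset.Icc 1 (k - 1), qGamma q (i + 1)

/-- The `q`-binomial coefficient `[n, m]_q = ∏_{i=1}^{m} (1 - q^{n-m+i}) / (1 - q^i)`
for an integer `n` and a natural number `m`; thus `[-1, 0]_q = 1` and `[m-1, m]_q = 0` for `m ≥ 1`. -/
def qBinom (q : ℝ) (n : ℤ) (m : ℕ) : ℝ :=
  ∏ i ∈ Finset.Icc 1 m, (1 - q ^ (n - (m : ℤ) + (i : ℤ))) / (1 - q ^ i)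

theorem qPoch_ne_zero {q : ℝ} (hq : |q| ≠ 1) (k : ℕ) : qPoch q k ≠ 0 := by
  refine Finset.prod_ne_zero_iff.2 fun i hi => ?_
  have hi1 : i ≠ 0 := by have := (Finset.mem_Icc.1 hi).1; omega
  intro h
  apply hq
  have h1 : q ^ i = 1 := by linarith
  have h2 : |q| ^ i = 1 := by rw [← abs_pow, h1, abs_one]
  exact (pow_eq_one_iff_of_nonneg (abs_nonneg q) hi1).1 h2

/-- On natural numbers `m ≤ n` the `q`-binomial coefficient is the usual quotient of `q`-Gamma
values. -/
theorem qBinom_eq_qGamma {q : ℝ} (hq : |q| ≠ 1) {n m : ℕ} (h : m ≤ n) :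
    qBinom q n m = qGamma q (n + 1) / (qGamma q (m + 1) * qGamma q (n - m + 1)) := by
  obtain ⟨l, rfl⟩ := Nat.exists_eq_add_of_le h
  have hq1 : (1 - q) ≠ 0 := by
    intro h0
    apply hq
    have : q = 1 := by linarith
    simp [this]
  have key : ∀ m : ℕ, qPoch q (m + l) =
      qPoch q l * ∏ i ∈ Finset.Icc 1 m, (1 - q ^ (l + i)) := by
    intro m
    induction m with
    | zero => simp
    | succ m ih =>
      have e1 : qPoch q (m + 1 + l) = qPoch q (m + l) * (1 - q ^ (m + l + 1)) := by
        have : m + 1 + l = (m + l) + 1 := by ring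
        rw [this]
        exact Finset.prod_Icc_succ_top (by omega) _
      rw [e1, ih, Finset.prod_Icc_succ_top (by omega)]
      have : m + l + 1 = l + (m + 1) := by ring
      rw [this]
      ring
  have hnum : qBinom q ((m + l : ℕ) : ℤ) m =
      (∏ i ∈ Finset.Icc 1 m, (1 - q ^ (l + i))) / qPoch q m := by
    unfold qBinom qPoch
    rw [Finset.prod_div_distrib]
    congr 1
    refine Finset.prod_congr rfl fun i _ => ?_
    have : ((m + l : ℕ) : ℤ) - (m : ℤ) + (i : ℤ) = ((l + i : ℕ) : ℤ) := by push_cast; ring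
    rw [this, zpow_natCast]
  have hl := qPoch_ne_zero hq l
  have hm := qPoch_ne_zero hq m
  rw [hnum, Nat.add_sub_cancel_left]
  simp only [qGamma]
  rw [key m]
  field_simp
  ring

/-- The classical Barnes function at natural arguments: `G(k+1) = ∏_{i=1}^{k-1} Γ(i+1)`, `G(0) = 0`. -/
def barnesG : ℕ → ℝ
  | 0 => 0
  | k + 1 => ∏ i ∈ Finset.Icc 1 (k - 1), Real.Gamma ((i : ℝ) + 1)

/-- The complete homogeneous symmetric polynomial `h_m` for an integer index; it vanishes for `m < 0`. -/
def hsymmInt (n : ℕ) (m : ℤ) : MvPolynomial (Fin n) ℝ :=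
  if 0 ≤ m then MvPolynomial.hsymm (Fin n) ℝ m.toNat else 0

/-- The skew Schur polynomial `s_{μ/ν}(x_1, …, x_n) = det (h_{μ_a - ν_b - a + b})`. A partition is
the non-increasing list of its parts; entries beyond the end of the list are zero, and trailing
zeros are allowed (they do not change the determinant). -/
def skewSchur (n : ℕ) (μ ν : List ℕ) : MvPolynomial (Fin n) ℝ :=
  Matrix.det (Matrix.of fun a b : Fin (max μ.length ν.length) =>
    hsymmInt n ((μ.getD a 0 : ℤ) - (ν.getD b 0 : ℤ) - (a : ℤ) + (b : ℤ)))

/-- `s_{(N^d, j)/(k)}(1, q, …, q^{M-1})`. -/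
def skewSpec (q : ℝ) (N d j k M : ℕ) : ℝ :=
  MvPolynomial.eval (fun i : Fin M => q ^ (i : ℕ))
    (skewSchur M (List.replicate d N ++ [j]) [k])

/-- The explicit value of `s_{(N^d, j)/(k)}(1, q, …, q^{M-1})`. -/
def qFormula (q : ℝ) (N d j k M : ℕ) : ℝ :=
  q ^ (((d : ℤ) - 1) * j - d * k + (d : ℤ) * ((d : ℤ) - 1) * N / 2)
    * (qBarnes q (N + 2)
      * (qBarnes q (M + N + 2) / qBarnes q (M + 1))
      * (qBarnes q (M - d + 1) / qBarnes q (M - d + N + 2))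
      * (qBarnes q (d + 1) / qBarnes q (d + N + 2)))
    * ∑ r ∈ Finset.Icc (max j k) N,
        q ^ r
        * ((qGamma q (M - d + j + 1) * qGamma q (d + k + 1) * qGamma q (r + 1))
          / (qGamma q (j + 1) * qGamma q (k + 1) * qGamma q (M + r + 1)))
        * qBinom q ((M : ℤ) - d + r - k - 1) (r - k)
        * qBinom q ((d : ℤ) + r - j - 1) (r - j)

/-- The explicit value of `s_{(N^d, j)/(k)}(1^M)`. -/
def classicalFormula (N d j k M : ℕ) : ℝ :=
  (barnesG (N + 2)
      * (barnesG (M + N + 2) / barnesG (M + 1))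
      * (barnesG (M - d + 1) / barnesG (M - d + N + 2))
      * (barnesG (d + 1) / barnesG (d + N + 2)))
    * (Real.Gamma ((M : ℝ) - d + j + 1) / Real.Gamma ((j : ℝ) + 1))
    * (Real.Gamma ((d : ℝ) + k + 1) / Real.Gamma ((k : ℝ) + 1))
    * ∑ r ∈ Finset.Icc (max j k) N,
        (Real.Gamma ((r : ℝ) + 1) / Real.Gamma ((M : ℝ) + r + 1))
        * (Ring.choose ((M : ℤ) - d + r - k - 1) (r - k) : ℝ)
        * (Ring.choose ((d : ℤ) + r - j - 1) (r - j) : ℝ)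

/-- The symbol `Θ_{γ,δ}(z) = ∏_{i=0}^{δ-1} (1 + q^i z⁻¹) ∏_{i=1}^{γ} (1 + q^i z)`. -/
def thetaSymbol (q : ℝ) (γ δ : ℕ) (z : ℂ) : ℂ :=
  (∏ i ∈ Finset.range δ, (1 + (q : ℂ) ^ i * z⁻¹)) *
    ∏ i ∈ Finset.Icc 1 γ, (1 + (q : ℂ) ^ i * z)

/-- The average over the unit circle, `(2π)⁻¹ ∫_0^{2π} f(e^{iθ}) dθ`. -/
def circleMean (f : ℂ → ℂ) : ℂ :=
  (2 * (Real.pi : ℂ))⁻¹ * ∫ θ in (0 : ℝ)..(2 * Real.pi), f (Complex.exp (Complex.I * θ))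

/-- The Toeplitz matrix `T_N(f) = (d_{a-b})`, with `d_m` the `m`-th Fourier coefficient of `f`. -/
def toeplitz (f : ℂ → ℂ) (N : ℕ) : Matrix (Fin N) (Fin N) ℂ :=
  Matrix.of fun a b => circleMean fun z => f z * z ^ (-((a : ℤ) - (b : ℤ)))

/-- The normalisation
`((q;q)_{δ+n} (q;q)_{γ+n} / ((q;q)_n (q;q)_{δ+γ+n}))^{1/2}` (principal square root). -/
def biorthNorm (q : ℝ) (γ δ n : ℕ) : ℂ :=
  (((qPoch q (δ + n) * qPoch q (γ + n)) / (qPoch q n * qPoch q (δ + γ + n)) : ℝ) : ℂ)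
    ^ (1 / 2 : ℂ)

/-- The biorthogonal polynomial `p_n` of `Θ_{γ,δ}`. -/
def biorthP (q : ℝ) (γ δ n : ℕ) : Polynomial ℂ :=
  ∑ r ∈ Finset.range (n + 1), Polynomial.monomial r
    (biorthNorm q γ δ n * (((-1) ^ (n + r) * qBinom q n r
      * (qPoch q (γ + r) / qPoch q (γ + n))
      * (qPoch q (δ + n - r - 1) / qPoch q (δ - 1)) : ℝ) : ℂ))

/-- The biorthogonal polynomial `q_n` of `Θ_{γ,δ}`. -/
def biorthQ (q : ℝ) (γ δ n : ℕ) : Polynomial ℂ :=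
  ∑ r ∈ Finset.range (n + 1), Polynomial.monomial r
    (biorthNorm q γ δ n * (((-1) ^ (n + r) * qBinom q n r
      * (qPoch q (γ + n - r - 1) / qPoch q (γ - 1))
      * (qPoch q (δ + r) / qPoch q (δ + n)) * q ^ (n - r) : ℝ) : ℂ))

end

/-!
The `q`-binomial theorem expands the symbol `Θ_{γ,δ}` and shows that the `n`-fold `q`-difference
annihilates the polynomials of degree less than `n` in `q^{-r}`. Up to a factor with one simple
pole, the products of the coefficients of `p_n` with Laurent coefficients of `Θ_{γ,δ}` are such
polynomials, so a partial fraction expansion yields the biorthogonality of `p_m` and `q_n`; that is,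
`Q T Pᵀ = D` with unitriangular `P`, `Q` and diagonal `D`. This factorisation gives both the
determinant and the inverse of the Toeplitz matrix `T`.

The generating functions of the `e_n` (with signs) and of the `h_n` are inverse to each other, so
the triangular Toeplitz matrices of their coefficients are inverse as well. The Jacobi-Trudi
determinant of `(N^d, j)/(k)` is a minor of the second, and Jacobi's complementary minor identity
turns it into an entry of the adjugate of a Toeplitz block of the first. At the principal
specialization the `e_n` are, up to a diagonal rescaling, the Laurent coefficients of `Θ_{M-d,d}`.
The value at `(1, …, 1)` follows by letting `q → 1`.
-/

section QFactorial

variable {q : ℝ}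

/-- The reciprocal `1 / (q;q)_m` at an integer `m`, set to zero for `m < 0`. With this convention
the quotients of `q`-factorials below vanish outside their natural range. -/
noncomputable def qPochInv (q : ℝ) (m : ℤ) : ℝ := if 0 ≤ m then (qPoch q m.toNat)⁻¹ else 0

/-- The shifted `q`-factorial `(q^c;q)_m = (1 - q^c) ⋯ (1 - q^(c+m-1))`. -/
noncomputable def qRising (q : ℝ) (c m : ℕ) : ℝ := ∏ i ∈ Finset.range m, (1 - q ^ (c + i))

theorem qPoch_zero (q : ℝ) : qPoch q 0 = 1 := by simp [qPoch]

theorem qPoch_succ (q : ℝ) (n : ℕ) : qPoch q (n + 1) = qPoch q n * (1 - q ^ (n + 1)) :=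
  Finset.prod_Icc_succ_top (by omega) _

theorem one_sub_pow_succ_ne_zero (hq : |q| ≠ 1) (n : ℕ) : 1 - q ^ (n + 1) ≠ 0 :=
  right_ne_zero_of_mul (qPoch_succ q n ▸ qPoch_ne_zero hq (n + 1))

theorem qPochInv_natCast (q : ℝ) (n : ℕ) : qPochInv q n = (qPoch q n)⁻¹ := by
  simp [qPochInv]

theorem qPochInv_of_neg (q : ℝ) {m : ℤ} (h : m < 0) : qPochInv q m = 0 := by
  simp [qPochInv, not_le.2 h]

theorem qPochInv_zero (q : ℝ) : qPochInv q 0 = 1 := by simp [qPochInv, qPoch_zero]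

theorem qPoch_mul_qPochInv (hq : |q| ≠ 1) (n : ℕ) : qPoch q n * qPochInv q n = 1 := by
  rw [qPochInv_natCast, mul_inv_cancel₀ (qPoch_ne_zero hq n)]

theorem qPochInv_sub_one (hq : |q| ≠ 1) (m : ℤ) :
    qPochInv q (m - 1) = qPochInv q m * (1 - q ^ m) := by
  rcases lt_trichotomy m 0 with h | rfl | h
  · rw [qPochInv_of_neg q h, qPochInv_of_neg q (by omega), zero_mul]
  · simp [qPochInv]
  · obtain ⟨n, rfl⟩ : ∃ n : ℕ, m = (n + 1 : ℕ) := ⟨(m - 1).toNat, by omega⟩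
    rw [Nat.cast_succ, add_sub_cancel_right, ← Nat.cast_succ, qPochInv_natCast, qPochInv_natCast,
      zpow_natCast, Nat.succ_eq_add_one, qPoch_succ, mul_inv,
      inv_mul_cancel_right₀ (one_sub_pow_succ_ne_zero hq n)]

theorem qPochInv_sub_natCast (hq : |q| ≠ 1) (m : ℤ) (s : ℕ) :
    qPochInv q (m - s) = qPochInv q m * ∏ i ∈ Finset.range s, (1 - q ^ (m - i)) := by
  induction s with
  | zero => simp
  | succ s ih =>
    rw [Nat.cast_succ, ← sub_sub, qPochInv_sub_one hq, ih, Finset.prod_range_succ, mul_assoc]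

theorem qPoch_mul_qPochInv_sub (hq : |q| ≠ 1) (n s : ℕ) :
    qPoch q n * qPochInv q ((n : ℤ) - s) = ∏ i ∈ Finset.range s, (1 - q ^ ((n : ℤ) - i)) := by
  rw [qPochInv_sub_natCast hq, ← mul_assoc, qPoch_mul_qPochInv hq, one_mul]

theorem qRising_zero_left (q : ℝ) {m : ℕ} (hm : 0 < m) : qRising q 0 m = 0 :=
  Finset.prod_eq_zero (Finset.mem_range.2 hm) (by simp)

theorem qRising_eq_prod_zpow (q : ℝ) (c m : ℕ) :
    qRising q c m = ∏ i ∈ Finset.range m, (1 - q ^ ((c : ℤ) + m - 1 - i)) := by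
  rw [qRising, ← Finset.prod_range_reflect]
  refine Finset.prod_congr rfl fun i hi => ?_
  have := Finset.mem_range.1 hi
  rw [← zpow_natCast]
  congr 2
  omega

theorem qRising_succ_left (hq : |q| ≠ 1) (c m : ℕ) :
    qRising q (c + 1) m = qPoch q (c + m) / qPoch q c := by
  induction m with
  | zero => simp [qRising, qPoch_ne_zero hq c]
  | succ m ih =>
    rw [qRising, Finset.prod_range_succ, ← qRising, ih, ← add_assoc, qPoch_succ,
      add_right_comm c 1 m, div_mul_eq_mul_div]

theorem qBinom_eq_div (q : ℝ) (n : ℤ) (m : ℕ) :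
    qBinom q n m = (∏ i ∈ Finset.range m, (1 - q ^ (n - i))) / qPoch q m := by
  rw [qBinom, Finset.prod_div_distrib, qPoch, ← Finset.prod_range_reflect,
    ← Finset.Ico_succ_right_eq_Icc, Finset.prod_Ico_eq_prod_range]
  congr 1
  refine Finset.prod_congr rfl fun i hi => ?_
  have hi : i < m := by simpa using hi
  congr 2
  push_cast
  omega

theorem qBinom_natCast (hq : |q| ≠ 1) (n r : ℕ) :
    qBinom q n r = qPoch q n * qPochInv q r * qPochInv q ((n : ℤ) - r) := by
  rw [qBinom_eq_div, ← qPoch_mul_qPochInv_sub hq, qPochInv_natCast]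
  ring

theorem qBinom_add_sub_one (q : ℝ) (c m : ℕ) :
    qBinom q ((c : ℤ) + m - 1) m = qRising q c m / qPoch q m := by
  rw [qBinom_eq_div, qRising_eq_prod_zpow]

theorem qBinom_natCast_of_lt (hq : |q| ≠ 1) {n r : ℕ} (h : n < r) : qBinom q n r = 0 := by
  rw [qBinom_natCast hq, qPochInv_of_neg q (m := (n : ℤ) - r) (by omega), mul_zero]

theorem qBinom_zero_right (q : ℝ) (n : ℤ) : qBinom q n 0 = 1 := by simp [qBinom]

theorem qBinom_natCast_self (hq : |q| ≠ 1) (n : ℕ) : qBinom q n n = 1 := by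
  rw [qBinom_natCast hq, sub_self, qPochInv_zero, mul_one, qPoch_mul_qPochInv hq]

theorem qBinom_succ_succ (hq0 : q ≠ 0) (hq : |q| ≠ 1) (n r : ℕ) :
    q ^ r * qBinom q (n + 1 : ℕ) (r + 1) = q ^ r * qBinom q n (r + 1) + q ^ n * qBinom q n r := by
  have hr : qPochInv q r = qPochInv q (r + 1 : ℕ) * (1 - q ^ (r + 1)) := by
    rw [← zpow_natCast, ← qPochInv_sub_one hq]
    simp
  have hnr : qPochInv q ((n : ℤ) - (r + 1 : ℕ)) =
      qPochInv q ((n : ℤ) - r) * (1 - q ^ n / q ^ r) := by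
    rw [← zpow_natCast, ← zpow_natCast, ← zpow_sub₀ hq0, ← qPochInv_sub_one hq]
    congr 1
    push_cast
    ring
  rw [qBinom_natCast hq, qBinom_natCast hq, qBinom_natCast hq, qPoch_succ, hr, hnr,
    show ((n + 1 : ℕ) : ℤ) - (r + 1 : ℕ) = (n : ℤ) - r by push_cast; ring]
  field_simp
  ring

end QFactorial

section QDifference

variable {q : ℝ}

/-- The `n`-fold `q`-difference `∑_r (-1)^r [n, r]_q q^{r(r-1)/2} f(r)` of a sequence `f`. It is
the functional through which the `q`-binomial theorem enters the biorthogonality relations. -/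
noncomputable def qDiff (q : ℝ) (n : ℕ) (f : ℕ → ℝ) : ℝ :=
  ∑ r ∈ Finset.range (n + 1), (-1) ^ r * qBinom q n r * q ^ (r.choose 2) * f r

theorem qDiff_zero (q : ℝ) (f : ℕ → ℝ) : qDiff q 0 f = f 0 := by
  simp [qDiff, qBinom_zero_right]

theorem qDiff_succ (hq0 : q ≠ 0) (hq : |q| ≠ 1) (n : ℕ) (f : ℕ → ℝ) :
    qDiff q (n + 1) f = qDiff q n f - q ^ n * qDiff q n (fun r => f (r + 1)) := by
  have hext : qDiff q n f = ∑ r ∈ Finset.range (n + 2),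
      (-1) ^ r * qBinom q n r * q ^ (r.choose 2) * f r := by
    rw [Finset.sum_range_succ, qBinom_natCast_of_lt hq n.lt_succ_self, qDiff]
    simp
  rw [hext, qDiff, qDiff, Finset.sum_range_succ', Finset.sum_range_succ' _ (n + 1),
    Finset.mul_sum, qBinom_zero_right, qBinom_zero_right, add_sub_right_comm,
    ← Finset.sum_sub_distrib]
  congr 1
  refine Finset.sum_congr rfl fun r _ => ?_
  rw [Nat.choose_succ_succ' r 1, Nat.choose_one_right]
  linear_combination (-1) ^ (r + 1) * q ^ r.choose 2 * f (r + 1) * qBinom_succ_succ hq0 hq n r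

theorem qDiff_congr {n : ℕ} {f g : ℕ → ℝ} (h : ∀ r ≤ n, f r = g r) :
    qDiff q n f = qDiff q n g :=
  Finset.sum_congr rfl fun r hr => by rw [h r (Nat.lt_succ_iff.1 (Finset.mem_range.1 hr))]

theorem qDiff_const_mul (q : ℝ) (n : ℕ) (c : ℝ) (f : ℕ → ℝ) :
    qDiff q n (fun r => c * f r) = c * qDiff q n f := by
  simp only [qDiff, Finset.mul_sum, mul_left_comm]

theorem qDiff_sub (q : ℝ) (n : ℕ) (f g : ℕ → ℝ) :
    qDiff q n (fun r => f r - g r) = qDiff q n f - qDiff q n g := by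
  simp only [qDiff, mul_sub, Finset.sum_sub_distrib]

theorem qDiff_sum (q : ℝ) (n : ℕ) {ι : Type*} (s : Finset ι) (f : ι → ℕ → ℝ) :
    qDiff q n (fun r => ∑ i ∈ s, f i r) = ∑ i ∈ s, qDiff q n (f i) := by
  simp only [qDiff, Finset.mul_sum]
  exact Finset.sum_comm

theorem qDiff_pow (hq0 : q ≠ 0) (hq : |q| ≠ 1) (n : ℕ) (x : ℝ) :
    qDiff q n (fun r => x ^ r) = ∏ i ∈ Finset.range n, (1 - q ^ i * x) := by
  induction n with
  | zero => simp [qDiff_zero]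
  | succ n ih =>
    simp only [qDiff_succ hq0 hq, pow_succ', qDiff_const_mul, ih, Finset.prod_range_succ]
    ring

theorem qDiff_inv_pow_eq_zero (hq0 : q ≠ 0) (hq : |q| ≠ 1) {m n : ℕ} (h : m < n) :
    qDiff q n (fun r => (q⁻¹ ^ r) ^ m) = 0 := by
  simp only [pow_right_comm _ _ m, qDiff_pow hq0 hq]
  refine Finset.prod_eq_zero (Finset.mem_range.2 h) ?_
  rw [inv_pow, mul_inv_cancel₀ (pow_ne_zero _ hq0), sub_self]

theorem qDiff_inv_one_sub (hq0 : q ≠ 0) (hq : |q| ≠ 1) (n : ℕ) (a : ℝ)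
    (ha : ∀ r ≤ n, 1 - a * q⁻¹ ^ r ≠ 0) :
    qDiff q n (fun r => (1 - a * q⁻¹ ^ r)⁻¹) =
      (-a) ^ n * qPoch q n /
        (q ^ (n + 1).choose 2 * ∏ r ∈ Finset.range (n + 1), (1 - a * q⁻¹ ^ r)) := by
  induction n generalizing a with
  | zero => simp [qDiff_zero, qPoch_zero]
  | succ n ih =>
    have hshift : ∀ r : ℕ, 1 - a * q⁻¹ ^ (r + 1) = 1 - a * q⁻¹ * q⁻¹ ^ r := fun r => by ring
    have hD : ∏ r ∈ Finset.range n, (1 - a * q⁻¹ ^ (r + 1)) ≠ 0 :=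
      Finset.prod_ne_zero_iff.2 fun r hr => ha _ (by have := Finset.mem_range.1 hr; omega)
    have h0 : 1 - a ≠ 0 := by simpa using ha 0 (Nat.zero_le _)
    have hn := ha (n + 1) le_rfl
    rw [qDiff_succ hq0 hq, ih a fun r hr => ha r (by omega)]
    simp only [hshift]
    rw [ih (a * q⁻¹) fun r hr => hshift r ▸ ha (r + 1) (by omega)]
    simp only [← hshift]
    rw [Finset.prod_range_succ' _ (n + 1), Finset.prod_range_succ' _ n,
      Finset.prod_range_succ _ n, show (n + 1 + 1).choose 2 = n + 1 + (n + 1).choose 2 by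
        rw [Nat.choose_succ_succ' (n + 1) 1, Nat.choose_one_right],
      qPoch_succ, pow_zero, mul_one]
    generalize ∏ r ∈ Finset.range n, (1 - a * q⁻¹ ^ (r + 1)) = D at hD ⊢
    have hpow : q ^ n * (-(a * q⁻¹)) ^ n = (-a) ^ n := by
      rw [← mul_pow]
      congr 1
      field_simp
    rw [inv_pow] at hn
    rw [← mul_div_assoc, ← mul_assoc (q ^ n), hpow, pow_succ (-a), inv_pow, pow_add q (n + 1)]
    have hQ : q ^ (n + 1) ≠ 0 := pow_ne_zero _ hq0
    generalize q ^ (n + 1) = Q at hn hQ ⊢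
    have hQa : Q - a ≠ 0 := fun h => hn (by rw [← sub_eq_zero.1 h, mul_inv_cancel₀ hQ, sub_self])
    -- with `Q = q^(n+1)` this is the partial fraction expansion of `1 / ((1 - a) (1 - a / Q))`
    field_simp
    ring

theorem qDiff_pow_div (hq0 : q ≠ 0) (hq : |q| ≠ 1) {m n : ℕ} (h : m ≤ n) {a : ℝ}
    (ha0 : a ≠ 0) (ha : ∀ r ≤ n, 1 - a * q⁻¹ ^ r ≠ 0) :
    qDiff q n (fun r => (q⁻¹ ^ r) ^ m * (1 - a * q⁻¹ ^ r)⁻¹) =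
      a⁻¹ ^ m * qDiff q n (fun r => (1 - a * q⁻¹ ^ r)⁻¹) := by
  induction m with
  | zero => simp
  | succ m ih =>
    rw [pow_succ', mul_assoc, ← ih (by omega), ← qDiff_const_mul, ← sub_eq_zero, ← qDiff_sub]
    have hlow : qDiff q n (fun r => -a⁻¹ * (q⁻¹ ^ r) ^ m) = 0 := by
      rw [qDiff_const_mul, qDiff_inv_pow_eq_zero hq0 hq (by omega), mul_zero]
    rw [← hlow]
    refine qDiff_congr fun r hr => ?_
    have := ha r hr
    generalize q⁻¹ ^ r = y at *
    field_simp
    ring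

theorem qDiff_eval_div (hq0 : q ≠ 0) (hq : |q| ≠ 1) {n : ℕ} {p : Polynomial ℝ}
    (h : p.natDegree ≤ n) {a : ℝ} (ha0 : a ≠ 0) (ha : ∀ r ≤ n, 1 - a * q⁻¹ ^ r ≠ 0) :
    qDiff q n (fun r => p.eval (q⁻¹ ^ r) * (1 - a * q⁻¹ ^ r)⁻¹) =
      p.eval a⁻¹ * qDiff q n (fun r => (1 - a * q⁻¹ ^ r)⁻¹) := by
  simp only [Polynomial.eval_eq_sum_range' (Nat.lt_succ_of_le h), Finset.sum_mul, mul_assoc]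
  rw [qDiff_sum]
  refine Finset.sum_congr rfl fun m hm => ?_
  rw [qDiff_const_mul, qDiff_pow_div hq0 hq (Finset.mem_range_succ_iff.1 hm) ha0 ha]

end QDifference

section Biorthogonality

variable {q : ℝ}

/-- The coefficient of `z^m` in the Laurent expansion of `Θ_{γ,δ}`, that is
`[δ+γ, δ+m]_q q^{m(m+1)/2}`, extended by zero to all integers `m`. -/
noncomputable def thetaCoeff (q : ℝ) (γ δ : ℕ) (m : ℤ) : ℝ :=
  qPoch q (δ + γ) * qPochInv q (δ + m) * qPochInv q (γ - m) * q ^ (m * (m + 1) / 2)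

/-- The coefficient of `z^r` in `p_n / c_n`, the monic multiple of the biorthogonal polynomial
`p_n`; the quotient `(q;q)_{δ+n-r-1} / (q;q)_{δ-1}` is written as `(q^δ;q)_{n-r}`, which makes sense
for `δ = 0` as well. -/
noncomputable def pCoeff (q : ℝ) (γ δ n r : ℕ) : ℝ :=
  (-1) ^ (n + r) * qBinom q n r * (qPoch q (γ + r) / qPoch q (γ + n)) * qRising q δ (n - r)

/-- The coefficient of `z^r` in `q_n / c_n`, the monic multiple of the biorthogonal polynomial
`q_n`. -/
noncomputable def qCoeff (q : ℝ) (γ δ n r : ℕ) : ℝ := pCoeff q δ γ n r * q ^ (n - r)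

/-- The pairing `c_n⁻²` of the monic multiples of `p_n` and `q_n`. -/
noncomputable def biorthSq (q : ℝ) (γ δ n : ℕ) : ℝ :=
  (qPoch q n * qPoch q (δ + γ + n)) / (qPoch q (δ + n) * qPoch q (γ + n))

theorem biorthSq_ne_zero (hq : |q| ≠ 1) (γ δ n : ℕ) : biorthSq q γ δ n ≠ 0 := by
  simp [biorthSq, qPoch_ne_zero hq]

theorem pCoeff_of_lt (hq : |q| ≠ 1) (γ δ : ℕ) {n r : ℕ} (h : n < r) : pCoeff q γ δ n r = 0 := by
  simp [pCoeff, qBinom_natCast_of_lt hq h]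

theorem qCoeff_of_lt (hq : |q| ≠ 1) (γ δ : ℕ) {n r : ℕ} (h : n < r) : qCoeff q γ δ n r = 0 := by
  simp [qCoeff, pCoeff_of_lt hq δ γ h]

theorem pCoeff_self (hq : |q| ≠ 1) (γ δ n : ℕ) : pCoeff q γ δ n n = 1 := by
  simp [pCoeff, qRising, qBinom_natCast_self hq, qPoch_ne_zero hq, ← two_mul]

theorem qCoeff_self (hq : |q| ≠ 1) (γ δ n : ℕ) : qCoeff q γ δ n n = 1 := by
  simp [qCoeff, pCoeff_self hq]

theorem pCoeff_zero_of_lt (q : ℝ) (γ : ℕ) {n r : ℕ} (h : r < n) : pCoeff q γ 0 n r = 0 := by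
  rw [pCoeff, qRising_zero_left q (Nat.sub_pos_of_lt h), mul_zero]

theorem thetaCoeff_swap (hq0 : q ≠ 0) (γ δ : ℕ) (m : ℤ) :
    thetaCoeff q γ δ m = thetaCoeff q δ γ (-m) * q ^ m := by
  have h : m * (m + 1) / 2 = -m * (-m + 1) / 2 + m := by
    rw [show m * (m + 1) = -m * (-m + 1) + m * 2 by ring, Int.add_mul_ediv_right _ _ two_ne_zero]
  rw [thetaCoeff, thetaCoeff, h, zpow_add₀ hq0, add_comm δ γ, sub_neg_eq_add, ← sub_eq_add_neg]
  ring

theorem zpow_triangle_sub (hq0 : q ≠ 0) (s r : ℕ) :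
    q ^ ((((s : ℤ) - r) * ((s : ℤ) - r + 1)) / 2) =
      q ^ ((s + 1).choose 2) * q ^ (r.choose 2) * (q⁻¹ ^ r) ^ s := by
  have h : (((s : ℤ) - r) * ((s : ℤ) - r + 1)) / 2 =
      ((s + 1).choose 2 : ℕ) + (r.choose 2 : ℕ) - (r * s : ℕ) := by
    refine Int.ediv_eq_of_eq_mul_left two_ne_zero ?_
    qify
    rw [Nat.cast_choose_two, Nat.cast_choose_two]
    push_cast
    ring
  rw [h, zpow_sub₀ hq0, zpow_add₀ hq0, zpow_natCast, zpow_natCast, zpow_natCast, inv_pow, inv_pow,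
    pow_mul, div_eq_mul_inv]

/-- The polynomial in `y = q^{-r}` through which the product of the `r`-dependent factors of
`pCoeff q γ δ n r` and `thetaCoeff q γ δ (s - r)` depends on `r`, up to a factor
`1 / (1 - q^(δ+n) y)`. -/
noncomputable def summandPoly (q : ℝ) (γ δ n s : ℕ) : Polynomial ℝ :=
  (∏ i ∈ Finset.range s, (Polynomial.X - Polynomial.C (q ^ ((γ : ℤ) - i)))) *
    ∏ i ∈ Finset.range (n - s), (1 - Polynomial.C (q ^ ((δ : ℤ) + n - i)) * Polynomial.X)

theorem eval_summandPoly (q : ℝ) (γ δ n s : ℕ) (y : ℝ) :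
    (summandPoly q γ δ n s).eval y = (∏ i ∈ Finset.range s, (y - q ^ ((γ : ℤ) - i))) *
      ∏ i ∈ Finset.range (n - s), (1 - q ^ ((δ : ℤ) + n - i) * y) := by
  simp [summandPoly, Polynomial.eval_prod]

theorem natDegree_summandPoly_le (q : ℝ) (γ δ : ℕ) {n s : ℕ} (hs : s ≤ n) :
    (summandPoly q γ δ n s).natDegree ≤ n := by
  have h : ∀ i, (1 - Polynomial.C (q ^ ((δ : ℤ) + n - i)) * Polynomial.X).natDegree ≤ 1 :=
    fun i => by compute_degree
  refine Polynomial.natDegree_mul_le.trans (le_trans (add_le_add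
    (Polynomial.natDegree_prod_le _ _) (Polynomial.natDegree_prod_le _ _)) ?_)
  refine le_trans (add_le_add (Finset.sum_le_card_nsmul _ _ 1 fun i _ => by simp)
    (Finset.sum_le_card_nsmul _ _ 1 fun i _ => h i)) ?_
  simp only [Finset.card_range, smul_eq_mul, mul_one]
  omega

theorem zpow_mul_inv_pow (hq0 : q ≠ 0) (c : ℤ) (r : ℕ) : q ^ c * q⁻¹ ^ r = q ^ (c - r) := by
  rw [zpow_sub₀ hq0, zpow_natCast, inv_pow, div_eq_mul_inv]

theorem one_sub_pole_eq (hq0 : q ≠ 0) (δ : ℕ) {n r : ℕ} (hr : r ≤ n) :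
    1 - q ^ (δ + 1 + n) * q⁻¹ ^ r = 1 - q ^ (δ + (n - r) + 1) := by
  rw [← zpow_natCast, zpow_mul_inv_pow hq0, ← zpow_natCast]
  congr 2
  omega

theorem inv_pow_mul_qPoch_mul_qPochInv (hq0 : q ≠ 0) (hq : |q| ≠ 1) (γ r s : ℕ) :
    (q⁻¹ ^ r) ^ s * (qPoch q (γ + r) * qPochInv q (γ - ((s : ℤ) - r))) =
      ∏ i ∈ Finset.range s, (q⁻¹ ^ r - q ^ ((γ : ℤ) - i)) := by
  rw [show (γ : ℤ) - ((s : ℤ) - r) = (γ + r : ℕ) - (s : ℤ) by push_cast; ring,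
    qPoch_mul_qPochInv_sub hq, show (q⁻¹ ^ r) ^ s = (q⁻¹ ^ r) ^ (Finset.range s).card by
      rw [Finset.card_range], Finset.pow_card_mul_prod]
  refine Finset.prod_congr rfl fun i _ => ?_
  rw [mul_sub, mul_one, mul_comm, zpow_mul_inv_pow hq0]
  congr 2
  push_cast
  ring

theorem qRising_mul_qPochInv (hq0 : q ≠ 0) (hq : |q| ≠ 1) (δ : ℕ) {n r s : ℕ}
    (hr : r ≤ n) (hs : s ≤ n) :
    qRising q (δ + 1) (n - r) * qPochInv q ((δ + 1 : ℕ) + ((s : ℤ) - r)) =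
      (∏ i ∈ Finset.range (n - s), (1 - q ^ (((δ + 1 : ℕ) : ℤ) + n - i) * q⁻¹ ^ r)) *
        (1 - q ^ (δ + 1 + n) * q⁻¹ ^ r)⁻¹ / qPoch q δ := by
  have hindex : ((δ + 1 : ℕ) : ℤ) + ((s : ℤ) - r) =
      (δ + (n - r) + 1 : ℕ) - ((n - s : ℕ) : ℤ) := by omega
  have hprod : ∏ i ∈ Finset.range (n - s), (1 - q ^ (((δ + 1 : ℕ) : ℤ) + n - i) * q⁻¹ ^ r) =
      ∏ i ∈ Finset.range (n - s), (1 - q ^ (((δ + (n - r) + 1 : ℕ) : ℤ) - i)) :=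
    Finset.prod_congr rfl fun i _ => by
      rw [zpow_mul_inv_pow hq0]
      congr 2
      omega
  rw [one_sub_pole_eq hq0 δ hr, hindex, hprod, ← qPoch_mul_qPochInv_sub hq, qRising_succ_left hq,
    qPoch_succ]
  have := one_sub_pow_succ_ne_zero hq (δ + (n - r))
  have := qPoch_ne_zero hq δ
  field_simp

theorem pCoeff_mul_thetaCoeff (hq0 : q ≠ 0) (hq : |q| ≠ 1) (γ δ : ℕ) {n r s : ℕ}
    (hr : r ≤ n) (hs : s ≤ n) :
    pCoeff q γ (δ + 1) n r * thetaCoeff q γ (δ + 1) ((s : ℤ) - r) =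
      (-1) ^ n * qPoch q (δ + 1 + γ) * q ^ ((s + 1).choose 2) / (qPoch q (γ + n) * qPoch q δ) *
        ((-1) ^ r * qBinom q n r * q ^ (r.choose 2) *
          ((summandPoly q γ (δ + 1) n s).eval (q⁻¹ ^ r) *
            (1 - q ^ (δ + 1 + n) * q⁻¹ ^ r)⁻¹)) := by
  have hδ := qRising_mul_qPochInv hq0 hq δ hr hs
  rw [pCoeff, thetaCoeff, zpow_triangle_sub hq0, eval_summandPoly,
    ← inv_pow_mul_qPoch_mul_qPochInv hq0 hq, pow_add]
  linear_combination (-1) ^ n * (-1) ^ r * qBinom q n r * (qPoch q (γ + r) / qPoch q (γ + n)) *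
    qPoch q (δ + 1 + γ) * qPochInv q (γ - ((s : ℤ) - r)) *
    (q ^ ((s + 1).choose 2) * q ^ (r.choose 2) * (q⁻¹ ^ r) ^ s) * hδ

theorem eval_summandPoly_pole_of_lt (hq0 : q ≠ 0) (γ δ : ℕ) {n s : ℕ} (hs : s < n) :
    (summandPoly q γ δ n s).eval (q ^ (δ + n))⁻¹ = 0 := by
  rw [eval_summandPoly, Finset.prod_eq_zero (s := Finset.range (n - s)) (i := 0)
    (Finset.mem_range.2 (Nat.sub_pos_of_lt hs)), mul_zero]
  have := pow_ne_zero (δ + n) hq0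
  rw [Nat.cast_zero, sub_zero, ← Nat.cast_add, zpow_natCast, mul_inv_cancel₀ this, sub_self]

theorem pow_mul_eval_summandPoly_pole_self (hq0 : q ≠ 0) (hq : |q| ≠ 1) (γ δ n : ℕ) :
    (q ^ (δ + n)) ^ n * (summandPoly q γ δ n n).eval (q ^ (δ + n))⁻¹ =
      qPoch q (δ + γ + n) / qPoch q (δ + γ) := by
  have ha := pow_ne_zero (δ + n) hq0
  rw [← qRising_succ_left hq, qRising_eq_prod_zpow, eval_summandPoly, Nat.sub_self,
    Finset.range_zero, Finset.prod_empty, mul_one,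
    show (q ^ (δ + n)) ^ n = (q ^ (δ + n)) ^ (Finset.range n).card by rw [Finset.card_range],
    Finset.pow_card_mul_prod]
  refine Finset.prod_congr rfl fun i _ => ?_
  rw [mul_sub, mul_inv_cancel₀ ha, ← zpow_natCast, ← zpow_add₀ hq0]
  congr 2
  push_cast
  ring

theorem prod_one_sub_pole (hq0 : q ≠ 0) (hq : |q| ≠ 1) (δ n : ℕ) :
    ∏ r ∈ Finset.range (n + 1), (1 - q ^ (δ + 1 + n) * q⁻¹ ^ r) =
      qPoch q (δ + 1 + n) / qPoch q δ := by
  rw [show δ + 1 + n = δ + (n + 1) by ring, ← qRising_succ_left hq, qRising_eq_prod_zpow]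
  refine Finset.prod_congr rfl fun r _ => ?_
  rw [← zpow_natCast, zpow_mul_inv_pow hq0]
  congr 2
  push_cast
  ring

theorem sum_pCoeff_mul_thetaCoeff_succ (hq0 : q ≠ 0) (hq : |q| ≠ 1) (γ δ : ℕ) {n s : ℕ}
    (hs : s ≤ n) :
    ∑ r ∈ Finset.range (n + 1), pCoeff q γ (δ + 1) n r * thetaCoeff q γ (δ + 1) ((s : ℤ) - r) =
      if s = n then biorthSq q γ (δ + 1) n else 0 := by
  have hpole : ∀ r ≤ n, 1 - q ^ (δ + 1 + n) * q⁻¹ ^ r ≠ 0 := fun r hr =>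
    one_sub_pole_eq hq0 δ hr ▸ one_sub_pow_succ_ne_zero hq _
  have hdiff := qDiff_eval_div hq0 hq (natDegree_summandPoly_le q γ (δ + 1) hs)
    (pow_ne_zero (δ + 1 + n) hq0) hpole
  rw [Finset.sum_congr rfl fun r hr => pCoeff_mul_thetaCoeff hq0 hq γ δ
    (Finset.mem_range_succ_iff.1 hr) hs, ← Finset.mul_sum, ← qDiff, hdiff]
  rcases hs.lt_or_eq with hlt | rfl
  · rw [eval_summandPoly_pole_of_lt hq0 γ (δ + 1) hlt, zero_mul, mul_zero, if_neg hlt.ne]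
  · have hsign : (-1 : ℝ) ^ s * (-1) ^ s = 1 := by rw [← mul_pow, neg_one_mul, neg_neg, one_pow]
    have heval := pow_mul_eval_summandPoly_pole_self hq0 hq γ (δ + 1) s
    have hP := qPoch_ne_zero hq
    rw [if_pos rfl, qDiff_inv_one_sub hq0 hq s _ hpole, prod_one_sub_pole hq0 hq, neg_pow,
      biorthSq, mul_div_assoc, ← (eq_div_iff (hP _)).1 heval]
    generalize (summandPoly q γ (δ + 1) s s).eval (q ^ (δ + 1 + s))⁻¹ = U
    have := pow_ne_zero ((s + 1).choose 2) hq0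
    have := hP (γ + s)
    have := hP (δ + 1 + s)
    have := hP δ
    field_simp
    linear_combination (qPoch q (δ + 1 + γ) * U * (q ^ (δ + 1 + s)) ^ s * qPoch q s) * hsign

theorem sum_pCoeff_mul_thetaCoeff (hq0 : q ≠ 0) (hq : |q| ≠ 1) (γ δ : ℕ) {n s : ℕ} (hs : s ≤ n) :
    ∑ r ∈ Finset.range (n + 1), pCoeff q γ δ n r * thetaCoeff q γ δ ((s : ℤ) - r) =
      if s = n then biorthSq q γ δ n else 0 := by
  rcases δ with _ | δ
  · have hP := qPoch_ne_zero hq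
    rw [Finset.sum_range_succ, Finset.sum_eq_zero fun r hr => by
      rw [pCoeff_zero_of_lt q γ (Finset.mem_range.1 hr), zero_mul], zero_add, pCoeff_self hq,
      one_mul, thetaCoeff]
    rcases hs.lt_or_eq with hlt | rfl
    · rw [qPochInv_of_neg q (by push_cast; omega), if_neg hlt.ne]
      ring
    · simp [qPochInv_zero, qPochInv_natCast, biorthSq, hP]
  · exact sum_pCoeff_mul_thetaCoeff_succ hq0 hq γ δ hs

theorem sum_qCoeff_mul_thetaCoeff_eq_zero (hq0 : q ≠ 0) (hq : |q| ≠ 1) (γ δ : ℕ) {n r : ℕ}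
    (h : r < n) :
    ∑ s ∈ Finset.range (n + 1), qCoeff q γ δ n s * thetaCoeff q γ δ ((s : ℤ) - r) = 0 := by
  have key := sum_pCoeff_mul_thetaCoeff hq0 hq δ γ h.le
  rw [if_neg h.ne] at key
  rw [← mul_zero (q ^ ((n : ℤ) - r)), ← key, Finset.mul_sum]
  refine Finset.sum_congr rfl fun s hs => ?_
  have hpow : q ^ ((n : ℤ) - r) = q ^ (n - s) * q ^ ((s : ℤ) - r) := by
    rw [← zpow_natCast, ← zpow_add₀ hq0, Nat.cast_sub (Finset.mem_range_succ_iff.1 hs),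
      sub_add_sub_cancel]
  rw [thetaCoeff_swap hq0 γ δ, neg_sub, qCoeff, hpow]
  ring

theorem sum_qCoeff_mul_thetaCoeff_mul_pCoeff (hq0 : q ≠ 0) (hq : |q| ≠ 1) (γ δ m n : ℕ) :
    ∑ s ∈ Finset.range (n + 1), ∑ r ∈ Finset.range (m + 1),
      qCoeff q γ δ n s * thetaCoeff q γ δ ((s : ℤ) - r) * pCoeff q γ δ m r =
        if m = n then biorthSq q γ δ n else 0 := by
  rcases lt_or_ge m n with h | h
  · rw [if_neg h.ne, Finset.sum_comm]
    refine Finset.sum_eq_zero fun r hr => ?_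
    rw [← Finset.sum_mul, sum_qCoeff_mul_thetaCoeff_eq_zero hq0 hq γ δ
      ((Finset.mem_range_succ_iff.1 hr).trans_lt h), zero_mul]
  · have hinner : ∀ s ∈ Finset.range (n + 1), ∑ r ∈ Finset.range (m + 1),
        qCoeff q γ δ n s * thetaCoeff q γ δ ((s : ℤ) - r) * pCoeff q γ δ m r =
          if s = m then qCoeff q γ δ n m * biorthSq q γ δ m else 0 := fun s hs => by
      have := sum_pCoeff_mul_thetaCoeff hq0 hq γ δ ((Finset.mem_range_succ_iff.1 hs).trans h)
      simp only [mul_assoc, mul_comm (thetaCoeff q γ δ _), ← Finset.mul_sum, this]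
      split_ifs with hsm
      · rw [hsm]
      · rw [mul_zero]
    rw [Finset.sum_congr rfl hinner, Finset.sum_ite_eq']
    rcases h.eq_or_lt with rfl | hlt
    · rw [if_pos (Finset.self_mem_range_succ _), if_pos rfl, qCoeff_self hq, one_mul]
    · rw [if_neg hlt.ne', qCoeff_of_lt hq γ δ hlt, zero_mul, ite_self]

end Biorthogonality

section QGamma

variable {q : ℝ}

theorem one_sub_ne_zero_of_abs_ne_one (hq : |q| ≠ 1) : 1 - q ≠ 0 := by
  simpa using one_sub_pow_succ_ne_zero hq 0

theorem qGamma_succ (q : ℝ) (k : ℕ) : qGamma q (k + 1) = qPoch q k / (1 - q) ^ k := rfl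

theorem qGamma_succ_ne_zero (hq : |q| ≠ 1) (k : ℕ) : qGamma q (k + 1) ≠ 0 :=
  div_ne_zero (qPoch_ne_zero hq k) (pow_ne_zero _ (one_sub_ne_zero_of_abs_ne_one hq))

theorem qBarnes_one (q : ℝ) : qBarnes q 1 = 1 := by simp [qBarnes]

theorem qBarnes_succ_succ (q : ℝ) (k : ℕ) :
    qBarnes q (k + 2) = qBarnes q (k + 1) * qGamma q (k + 1) := by
  rcases k with _ | k
  · simp [qBarnes, qGamma_succ, qPoch_zero]
  · exact Finset.prod_Icc_succ_top (by omega) _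

theorem qBarnes_succ_ne_zero (hq : |q| ≠ 1) (k : ℕ) : qBarnes q (k + 1) ≠ 0 :=
  Finset.prod_ne_zero_iff.2 fun i _ => qGamma_succ_ne_zero hq i

end QGamma

section ThetaToeplitz

variable {q : ℝ}

/-- The rectangular Toeplitz matrix `(e_{s+a-b})` with `0 ≤ a < m` and `0 ≤ b < n`; the offset `s`
allows every contiguous block of the bi-infinite matrix `(e_{a-b})`, up to the indexing of its rows
and columns. -/
def toeplitzBlock {R : Type*} (e : ℤ → R) (s : ℤ) (m n : ℕ) : Matrix (Fin m) (Fin n) R :=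
  Matrix.of fun a b => e (s + a - b)

theorem toeplitzBlock_apply {R : Type*} (e : ℤ → R) (s : ℤ) (m n : ℕ) (a : Fin m) (b : Fin n) :
    toeplitzBlock e s m n a b = e (s + a - b) := rfl

/-- The real Toeplitz matrix of the Laurent coefficients of `Θ_{γ,δ}`. -/
noncomputable abbrev thetaToeplitz (q : ℝ) (γ δ N : ℕ) : Matrix (Fin N) (Fin N) ℝ :=
  toeplitzBlock (thetaCoeff q γ δ) 0 N N

/-- The matrix whose `n`-th row lists the coefficients of `p_n / c_n`. -/
noncomputable def pMatrix (q : ℝ) (γ δ N : ℕ) : Matrix (Fin N) (Fin N) ℝ :=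
  Matrix.of fun n r => pCoeff q γ δ n r

/-- The matrix whose `n`-th row lists the coefficients of `q_n / c_n`. -/
noncomputable def qMatrix (q : ℝ) (γ δ N : ℕ) : Matrix (Fin N) (Fin N) ℝ :=
  Matrix.of fun n r => qCoeff q γ δ n r

theorem sum_fin_eq_sum_range_succ {R : Type*} [AddCommMonoid R] {N n : ℕ} (hn : n < N)
    {f : ℕ → R} (hf : ∀ r, n < r → f r = 0) :
    ∑ r : Fin N, f r = ∑ r ∈ Finset.range (n + 1), f r := by
  rw [Fin.sum_univ_eq_sum_range]
  refine (Finset.sum_subset (Finset.range_subset_range.2 hn) fun r _ hr => hf r ?_).symm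
  simpa using hr

theorem qMatrix_mul_thetaToeplitz_mul_transpose (hq0 : q ≠ 0) (hq : |q| ≠ 1) (γ δ N : ℕ) :
    qMatrix q γ δ N * thetaToeplitz q γ δ N * (pMatrix q γ δ N).transpose =
      Matrix.diagonal fun n : Fin N => biorthSq q γ δ n := by
  ext n m
  have hp : ∀ s : ℕ, ∑ r : Fin N, qCoeff q γ δ n s * thetaCoeff q γ δ ((s : ℤ) - r) *
      pCoeff q γ δ m r = ∑ r ∈ Finset.range (m + 1), qCoeff q γ δ n s *
        thetaCoeff q γ δ ((s : ℤ) - r) * pCoeff q γ δ m r := fun s =>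
    sum_fin_eq_sum_range_succ (f := fun r => _ * thetaCoeff q γ δ (s - r) * pCoeff q γ δ m r)
      m.2 fun r hr => by rw [pCoeff_of_lt hq γ δ hr, mul_zero]
  have hq' := sum_fin_eq_sum_range_succ (f := fun s => ∑ r ∈ Finset.range (m + 1),
    qCoeff q γ δ n s * thetaCoeff q γ δ ((s : ℤ) - r) * pCoeff q γ δ m r) n.2
    fun s hs => by simp [qCoeff_of_lt hq γ δ hs]
  rw [sum_qCoeff_mul_thetaCoeff_mul_pCoeff hq0 hq] at hq'
  simp_rw [← hp, eq_comm (a := (m : ℕ)), ← Fin.ext_iff] at hq'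
  rw [Matrix.diagonal_apply, ← hq', Finset.sum_comm]
  simp only [Matrix.mul_apply, Matrix.transpose_apply, Finset.sum_mul, qMatrix, pMatrix,
    toeplitzBlock_apply, Matrix.of_apply, zero_add]

theorem det_pMatrix (hq : |q| ≠ 1) (γ δ N : ℕ) : (pMatrix q γ δ N).det = 1 := by
  have h : (pMatrix q γ δ N).IsLowerTriangular := fun a b hab => pCoeff_of_lt hq γ δ hab
  rw [Matrix.det_of_isLowerTriangular _ h]
  exact Finset.prod_eq_one fun n _ => pCoeff_self hq γ δ n

theorem det_qMatrix (hq : |q| ≠ 1) (γ δ N : ℕ) : (qMatrix q γ δ N).det = 1 := by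
  have h : (qMatrix q γ δ N).IsLowerTriangular := fun a b hab => qCoeff_of_lt hq γ δ hab
  rw [Matrix.det_of_isLowerTriangular _ h]
  exact Finset.prod_eq_one fun n _ => qCoeff_self hq γ δ n

theorem det_thetaToeplitz_eq_prod (hq0 : q ≠ 0) (hq : |q| ≠ 1) (γ δ N : ℕ) :
    (thetaToeplitz q γ δ N).det = ∏ n ∈ Finset.range N, biorthSq q γ δ n := by
  have h := congrArg Matrix.det (qMatrix_mul_thetaToeplitz_mul_transpose hq0 hq γ δ N)
  rw [Matrix.det_mul, Matrix.det_mul, Matrix.det_transpose, det_pMatrix hq, det_qMatrix hq,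
    Matrix.det_diagonal, one_mul, mul_one] at h
  rw [h, Fin.prod_univ_eq_prod_range (fun n => biorthSq q γ δ n)]

theorem isUnit_det_thetaToeplitz (hq0 : q ≠ 0) (hq : |q| ≠ 1) (γ δ N : ℕ) :
    IsUnit (thetaToeplitz q γ δ N).det := by
  rw [det_thetaToeplitz_eq_prod hq0 hq, isUnit_iff_ne_zero]
  exact Finset.prod_ne_zero_iff.2 fun n _ => biorthSq_ne_zero hq γ δ n

theorem det_thetaToeplitz (hq0 : q ≠ 0) (hq : |q| ≠ 1) (γ δ N : ℕ) :
    (thetaToeplitz q γ δ N).det = qBarnes q (N + 1)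
      * (qBarnes q (δ + γ + N + 1) / qBarnes q (δ + γ + 1))
      * (qBarnes q (δ + 1) / qBarnes q (δ + N + 1))
      * (qBarnes q (γ + 1) / qBarnes q (γ + N + 1)) := by
  have hB := qBarnes_succ_ne_zero hq
  rw [det_thetaToeplitz_eq_prod hq0 hq]
  induction N with
  | zero => simp [qBarnes_one, hB (δ + γ), hB δ, hB γ]
  | succ N ih =>
    have := hB (δ + γ)
    have := hB (δ + N)
    have := hB (γ + N)
    have := qPoch_ne_zero hq (δ + N)
    have := qPoch_ne_zero hq (γ + N)
    have := one_sub_ne_zero_of_abs_ne_one hq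
    rw [Finset.prod_range_succ, ih]
    simp only [← add_assoc, qBarnes_succ_succ, biorthSq, qGamma_succ, pow_add]
    field_simp

theorem pCoeff_mul_qCoeff_div_biorthSq (hq : |q| ≠ 1) (γ δ : ℕ) {a b r : ℕ} (ha : a ≤ r)
    (hb : b ≤ r) :
    pCoeff q γ δ r a * qCoeff q γ δ r b / biorthSq q γ δ r =
      (-1) ^ (a + b) * q ^ (r - b) * ((qGamma q (γ + a + 1) * qGamma q (δ + b + 1) *
        qGamma q (r + 1)) / (qGamma q (a + 1) * qGamma q (b + 1) * qGamma q (δ + γ + r + 1))) *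
        qBinom q ((γ : ℤ) + r - b - 1) (r - b) * qBinom q ((δ : ℤ) + r - a - 1) (r - a) := by
  have hγ := qBinom_add_sub_one q γ (r - b)
  have hδ := qBinom_add_sub_one q δ (r - a)
  have hsign : (-1 : ℝ) ^ (a + b) = (-1) ^ (r + a) * (-1) ^ (r + b) := by
    rw [← pow_add, show r + a + (r + b) = a + b + 2 * r by ring, pow_add _ _ (2 * r), pow_mul,
      neg_one_sq, one_pow, mul_one]
  rw [Nat.cast_sub hb, ← add_sub_assoc] at hγ
  rw [Nat.cast_sub ha, ← add_sub_assoc] at hδ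
  rw [hγ, hδ, hsign, qCoeff, pCoeff, pCoeff, biorthSq, qBinom_natCast hq, qBinom_natCast hq,
    ← Nat.cast_sub ha, ← Nat.cast_sub hb]
  simp only [qGamma_succ, qPochInv_natCast, pow_add]
  have hP := qPoch_ne_zero hq
  have := hP r
  have := hP a
  have := hP b
  have := hP (r - a)
  have := hP (r - b)
  have := hP (γ + r)
  have := hP (δ + r)
  have := hP (δ + γ + r)
  have := one_sub_ne_zero_of_abs_ne_one hq
  field_simp

/-- The entry of index `(a, b)`, counted from `0`, of the inverse of the Toeplitz matrix of
`Θ_{γ,δ}` of size `N + 1`. -/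
noncomputable def thetaInv (q : ℝ) (γ δ N a b : ℕ) : ℝ :=
  ∑ r ∈ Finset.Icc (max a b) N, (-1) ^ (a + b) * q ^ (r - b) *
    ((qGamma q (γ + a + 1) * qGamma q (δ + b + 1) * qGamma q (r + 1)) /
      (qGamma q (a + 1) * qGamma q (b + 1) * qGamma q (δ + γ + r + 1))) *
    qBinom q ((γ : ℤ) + r - b - 1) (r - b) * qBinom q ((δ : ℤ) + r - a - 1) (r - a)

theorem sum_pCoeff_mul_qCoeff_div_biorthSq (hq : |q| ≠ 1) (γ δ N a b : ℕ) :
    ∑ r ∈ Finset.range (N + 1), pCoeff q γ δ r a * qCoeff q γ δ r b / biorthSq q γ δ r =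
      thetaInv q γ δ N a b := by
  have hsub : Finset.Icc (max a b) N ⊆ Finset.range (N + 1) := fun r hr =>
    Finset.mem_range_succ_iff.2 (Finset.mem_Icc.1 hr).2
  rw [thetaInv, ← Finset.sum_subset hsub fun r hr hr' => ?_]
  · refine Finset.sum_congr rfl fun r hr => ?_
    have hmax := max_le_iff.1 (Finset.mem_Icc.1 hr).1
    exact pCoeff_mul_qCoeff_div_biorthSq hq γ δ hmax.1 hmax.2
  · have hlt : r < a ∨ r < b := by
      simp only [Finset.mem_range, Finset.mem_Icc] at hr hr'
      omega
    rcases hlt with h | h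
    · rw [pCoeff_of_lt hq γ δ h, zero_mul, zero_div]
    · rw [qCoeff_of_lt hq γ δ h, mul_zero, zero_div]

theorem inv_thetaToeplitz (hq0 : q ≠ 0) (hq : |q| ≠ 1) (γ δ N : ℕ) :
    (thetaToeplitz q γ δ (N + 1))⁻¹ =
      Matrix.of fun a b : Fin (N + 1) => thetaInv q γ δ N a b := by
  set P := pMatrix q γ δ (N + 1)
  set Q := qMatrix q γ δ (N + 1)
  set W := Matrix.diagonal fun n : Fin (N + 1) => (biorthSq q γ δ n)⁻¹
  have hright : (W * Q * thetaToeplitz q γ δ (N + 1)) * P.transpose = 1 := by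
    rw [mul_assoc W, mul_assoc W, qMatrix_mul_thetaToeplitz_mul_transpose hq0 hq,
      Matrix.diagonal_mul_diagonal, ← Matrix.diagonal_one]
    exact congrArg _ (funext fun n => inv_mul_cancel₀ (biorthSq_ne_zero hq γ δ n))
  have hleft : (P.transpose * (W * Q)) * thetaToeplitz q γ δ (N + 1) = 1 := by
    rw [mul_assoc]
    exact mul_eq_one_comm.1 hright
  rw [Matrix.inv_eq_left_inv hleft]
  ext a b
  rw [Matrix.of_apply, ← sum_pCoeff_mul_qCoeff_div_biorthSq hq, ← Fin.sum_univ_eq_sum_range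
    (fun r => pCoeff q γ δ r a * qCoeff q γ δ r b / biorthSq q γ δ r), Matrix.mul_apply]
  refine Finset.sum_congr rfl fun r _ => ?_
  rw [Matrix.diagonal_mul, Matrix.transpose_apply, div_eq_mul_inv, mul_comm _⁻¹, ← mul_assoc]
  rfl

end ThetaToeplitz

section ThetaExpansion

variable {q : ℝ}

theorem prod_one_sub_C_pow_mul_X (hq0 : q ≠ 0) (hq : |q| ≠ 1) (n : ℕ) :
    ∏ i ∈ Finset.range n, (1 - Polynomial.C (q ^ i) * Polynomial.X) =
      ∑ k ∈ Finset.range (n + 1),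
        Polynomial.C ((-1) ^ k * qBinom q n k * q ^ (k.choose 2)) * Polynomial.X ^ k := by
  refine Polynomial.funext fun y => ?_
  simpa [Polynomial.eval_prod, Polynomial.eval_finsetSum, qDiff] using (qDiff_pow hq0 hq n y).symm

theorem prod_one_add_pow_mul (hq0 : q ≠ 0) (hq : |q| ≠ 1) (n : ℕ) (x : ℂ) :
    ∏ i ∈ Finset.range n, (1 + (q : ℂ) ^ i * x) =
      ∑ k ∈ Finset.range (n + 1), ((qBinom q n k * q ^ (k.choose 2) : ℝ) : ℂ) * x ^ k := by
  have h := congrArg (Polynomial.aeval (-x)) (prod_one_sub_C_pow_mul_X hq0 hq n)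
  simp only [map_prod, map_sum, map_sub, map_mul, map_one, map_pow, Polynomial.aeval_C,
    Polynomial.aeval_X, mul_neg, sub_neg_eq_add, Complex.coe_algebraMap] at h
  rw [h]
  refine Finset.sum_congr rfl fun k _ => ?_
  have hsign : (-1 : ℂ) ^ k * (-1) ^ k = 1 := by rw [← mul_pow]; simp
  rw [neg_pow x]
  push_cast
  linear_combination ((qBinom q n k : ℂ) * (q : ℂ) ^ k.choose 2 * x ^ k) * hsign

theorem prod_one_add_pow_mul_inv (hq0 : q ≠ 0) (δ : ℕ) {z : ℂ} (hz : z ≠ 0) :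
    ∏ i ∈ Finset.range δ, (1 + (q : ℂ) ^ i * z⁻¹) = z⁻¹ ^ δ * (q : ℂ) ^ (δ.choose 2) *
      ∏ i ∈ Finset.range δ, (1 + (q : ℂ) ^ i * (q * z * (q : ℂ)⁻¹ ^ δ)) := by
  have hqC : (q : ℂ) ≠ 0 := by exact_mod_cast hq0
  have hchoose : (q : ℂ) ^ δ.choose 2 = ∏ i ∈ Finset.range δ, (q : ℂ) ^ i := by
    rw [Finset.prod_pow_eq_pow_sum, Finset.sum_range_id, Nat.choose_two_right]
  rw [hchoose, ← Finset.prod_range_reflect (fun i => 1 + (q : ℂ) ^ i * (q * z * (q : ℂ)⁻¹ ^ δ)),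
    Finset.pow_eq_prod_const, ← Finset.prod_mul_distrib, ← Finset.prod_mul_distrib]
  refine Finset.prod_congr rfl fun i hi => ?_
  have hpow : (q : ℂ) ^ δ = q ^ (δ - 1 - i) * q * q ^ i := by
    have := Finset.mem_range.1 hi
    rw [← pow_succ, ← pow_add]
    congr 1
    omega
  rw [inv_pow, hpow]
  field_simp
  ring

theorem thetaSymbol_eq_mul_prod (hq0 : q ≠ 0) (γ δ : ℕ) {z : ℂ} (hz : z ≠ 0) :
    thetaSymbol q γ δ z = z⁻¹ ^ δ * (q : ℂ) ^ (δ.choose 2) *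
      ∏ i ∈ Finset.range (δ + γ), (1 + (q : ℂ) ^ i * (q * z * (q : ℂ)⁻¹ ^ δ)) := by
  have hqC : (q : ℂ) ≠ 0 := by exact_mod_cast hq0
  rw [thetaSymbol, Finset.prod_range_add, ← mul_assoc, prod_one_add_pow_mul_inv hq0 δ hz,
    ← Finset.Ico_succ_right_eq_Icc, Finset.prod_Ico_eq_prod_range]
  congr 1
  refine Finset.prod_congr rfl fun i _ => ?_
  rw [pow_add, inv_pow]
  field_simp
  ring

theorem thetaCoeff_natCast_sub (hq0 : q ≠ 0) (hq : |q| ≠ 1) (γ δ k : ℕ) :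
    thetaCoeff q γ δ ((k : ℤ) - δ) =
      q ^ (δ.choose 2) * (qBinom q (δ + γ : ℕ) k * q ^ (k.choose 2)) * (q * q⁻¹ ^ δ) ^ k := by
  rw [thetaCoeff, zpow_triangle_sub hq0, qBinom_natCast hq, add_sub_cancel,
    show (γ : ℤ) - (k - δ) = (δ + γ : ℕ) - k by push_cast; ring,
    Nat.choose_succ_succ' k 1, Nat.choose_one_right, pow_add, mul_pow]
  ring

theorem thetaSymbol_eq_sum (hq0 : q ≠ 0) (hq : |q| ≠ 1) (γ δ : ℕ) {z : ℂ} (hz : z ≠ 0) :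
    thetaSymbol q γ δ z =
      ∑ m ∈ Finset.Icc (-(δ : ℤ)) (γ : ℤ), (thetaCoeff q γ δ m : ℂ) * z ^ m := by
  rw [thetaSymbol_eq_mul_prod hq0 γ δ hz, prod_one_add_pow_mul hq0 hq, Finset.mul_sum]
  refine Finset.sum_bij' (fun (k : ℕ) _ => (k : ℤ) - δ) (fun m _ => (m + δ).toNat)
    (fun k hk => ?_) (fun m hm => ?_) (fun k _ => by simp) (fun m hm => ?_) fun k _ => ?_
  · simp only [Finset.mem_range, Finset.mem_Icc] at hk ⊢
    omega
  · simp only [Finset.mem_range, Finset.mem_Icc] at hm ⊢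
    omega
  · rw [Finset.mem_Icc] at hm
    omega
  · rw [thetaCoeff_natCast_sub hq0 hq, zpow_sub₀ hz, zpow_natCast, zpow_natCast, inv_pow]
    push_cast
    rw [mul_pow, mul_pow, mul_pow]
    field_simp

theorem thetaCoeff_of_notMem (q : ℝ) {γ δ : ℕ} {m : ℤ}
    (h : m ∉ Finset.Icc (-(δ : ℤ)) (γ : ℤ)) : thetaCoeff q γ δ m = 0 := by
  rw [Finset.mem_Icc, not_and_or] at h
  rcases h with h | h
  · rw [thetaCoeff, qPochInv_of_neg q (m := δ + m) (by omega), mul_zero, zero_mul, zero_mul]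
  · rw [thetaCoeff, qPochInv_of_neg q (m := γ - m) (by omega), mul_zero, zero_mul]

theorem thetaCoeff_eq_qBinom (hq : |q| ≠ 1) {γ δ : ℕ} {m : ℤ} (h : -(δ : ℤ) ≤ m) :
    thetaCoeff q γ δ m =
      qBinom q ((δ : ℤ) + γ) ((δ : ℤ) + m).toNat * q ^ (m * (m + 1) / 2) := by
  obtain ⟨k, hk⟩ := Int.eq_ofNat_of_zero_le (neg_le_iff_add_nonneg'.1 h)
  rw [thetaCoeff, hk, Int.toNat_natCast, ← Nat.cast_add, qBinom_natCast hq,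
    show (γ : ℤ) - m = (δ + γ : ℕ) - k by omega]

theorem thetaSymbol_eq_sum_qBinom (hq0 : q ≠ 0) (hq : |q| ≠ 1) (γ δ : ℕ) {z : ℂ} (hz : z ≠ 0) :
    thetaSymbol q γ δ z = ∑ m ∈ Finset.Icc (-(δ : ℤ)) (γ : ℤ),
      ((qBinom q ((δ : ℤ) + γ) ((δ : ℤ) + m).toNat * q ^ (m * (m + 1) / 2) : ℝ) : ℂ) * z ^ m := by
  rw [thetaSymbol_eq_sum hq0 hq γ δ hz]
  exact Finset.sum_congr rfl fun m hm => by rw [thetaCoeff_eq_qBinom hq (Finset.mem_Icc.1 hm).1]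

end ThetaExpansion

section CircleMean

theorem circleMean_congr {f g : ℂ → ℂ} (h : ∀ z, z ≠ 0 → f z = g z) :
    circleMean f = circleMean g := by
  simp only [circleMean, h _ (Complex.exp_ne_zero _)]

theorem circleMean_zpow (m : ℤ) : circleMean (fun z => z ^ m) = if m = 0 then 1 else 0 := by
  have hpi : (Real.pi : ℂ) ≠ 0 := by exact_mod_cast Real.pi_ne_zero
  split_ifs with h
  · simp only [circleMean, h, zpow_zero, intervalIntegral.integral_const, sub_zero,
      Complex.real_smul, mul_one, Complex.ofReal_mul, Complex.ofReal_ofNat]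
    exact inv_mul_cancel₀ (mul_ne_zero two_ne_zero hpi)
  · have hm : (m : ℂ) * Complex.I ≠ 0 := mul_ne_zero (by exact_mod_cast h) Complex.I_ne_zero
    have hexp (θ : ℝ) : Complex.exp (Complex.I * θ) ^ m = Complex.exp (m * Complex.I * θ) := by
      rw [← Complex.exp_int_mul, mul_assoc]
    have hperiod : (m : ℂ) * Complex.I * (2 * Real.pi : ℝ) = m * (2 * Real.pi * Complex.I) := by
      push_cast
      ring
    simp only [circleMean, hexp]
    rw [integral_exp_mul_complex hm, hperiod, Complex.exp_int_mul_two_pi_mul_I]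
    simp

theorem circleMean_sum_zpow {ι : Type*} (s : Finset ι) (c : ι → ℂ) (e : ι → ℤ) :
    circleMean (fun z => ∑ i ∈ s, c i * z ^ e i) = ∑ i ∈ s, if e i = 0 then c i else 0 := by
  have hcont (m : ℤ) : Continuous fun θ : ℝ => Complex.exp (Complex.I * θ) ^ m :=
    Continuous.zpow₀ (by fun_prop) m fun θ => Or.inl (Complex.exp_ne_zero _)
  rw [circleMean, intervalIntegral.integral_finsetSum fun i _ =>
    ((hcont (e i)).const_mul (c i)).intervalIntegrable _ _, Finset.mul_sum]
  refine Finset.sum_congr rfl fun i _ => ?_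
  rw [intervalIntegral.integral_const_mul, mul_left_comm]
  change c i * circleMean (fun z => z ^ e i) = _
  rw [circleMean_zpow, mul_ite, mul_one, mul_zero]

variable {f : ℂ → ℂ} {S : Finset ℤ} {c : ℤ → ℂ}

theorem circleMean_sum_mul (hf : ∀ z, z ≠ 0 → f z = ∑ m ∈ S, c m * z ^ m)
    (hc : ∀ m, m ∉ S → c m = 0) {ι : Type*} (s : Finset ι) (a : ι → ℂ) (e : ι → ℤ) :
    circleMean (fun z => (∑ i ∈ s, a i * z ^ (-e i)) * f z) = ∑ i ∈ s, a i * c (e i) := by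
  have h (z : ℂ) (hz : z ≠ 0) : (∑ i ∈ s, a i * z ^ (-e i)) * f z =
      ∑ p ∈ s ×ˢ S, (a p.1 * c p.2) * z ^ (p.2 - e p.1) := by
    rw [hf z hz, Finset.sum_mul_sum, ← Finset.sum_product']
    refine Finset.sum_congr rfl fun p _ => ?_
    rw [sub_eq_add_neg, zpow_add₀ hz]
    ring
  rw [circleMean_congr h, circleMean_sum_zpow, Finset.sum_product]
  refine Finset.sum_congr rfl fun i _ => ?_
  simp only [sub_eq_zero, Finset.sum_ite_eq']
  split_ifs with hi
  · rfl
  · rw [hc _ hi, mul_zero]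

theorem toeplitz_eq_toeplitzBlock (hf : ∀ z, z ≠ 0 → f z = ∑ m ∈ S, c m * z ^ m)
    (hc : ∀ m, m ∉ S → c m = 0) (N : ℕ) : toeplitz f N = toeplitzBlock c 0 N N := by
  ext a b
  have h := circleMean_sum_mul hf hc {()} (fun _ => 1) fun _ => (a : ℤ) - b
  simp only [Finset.sum_singleton, one_mul] at h
  simp only [toeplitz, Matrix.of_apply, mul_comm (f _), h, toeplitzBlock_apply, zero_add]

theorem circleMean_eval_mul_eval_inv_mul (hf : ∀ z, z ≠ 0 → f z = ∑ m ∈ S, c m * z ^ m)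
    (hc : ∀ m, m ∉ S → c m = 0) (A B : Polynomial ℂ) :
    circleMean (fun z => A.eval z * B.eval z⁻¹ * f z) =
      ∑ s ∈ Finset.range (B.natDegree + 1), ∑ r ∈ Finset.range (A.natDegree + 1),
        B.coeff s * c ((s : ℤ) - r) * A.coeff r := by
  have h (z : ℂ) (hz : z ≠ 0) : A.eval z * B.eval z⁻¹ * f z =
      (∑ p ∈ Finset.range (B.natDegree + 1) ×ˢ Finset.range (A.natDegree + 1),
        (B.coeff p.1 * A.coeff p.2) * z ^ (-((p.1 : ℤ) - p.2))) * f z := by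
    rw [Polynomial.eval_eq_sum_range, Polynomial.eval_eq_sum_range, mul_comm (Finset.sum _ _),
      Finset.sum_mul_sum, ← Finset.sum_product']
    congr 1
    refine Finset.sum_congr rfl fun p _ => ?_
    rw [neg_sub, zpow_sub₀ hz, zpow_natCast, zpow_natCast, inv_pow]
    ring
  rw [circleMean_congr h, circleMean_sum_mul hf hc _
    (fun p : ℕ × ℕ => B.coeff p.1 * A.coeff p.2) (fun p => (p.1 : ℤ) - p.2), Finset.sum_product]
  exact Finset.sum_congr rfl fun s _ => Finset.sum_congr rfl fun r _ => mul_right_comm _ _ _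

end CircleMean

section ThetaSymbol

variable {q : ℝ}

theorem ofReal_thetaCoeff_of_notMem (q : ℝ) {γ δ : ℕ} (m : ℤ)
    (h : m ∉ Finset.Icc (-(δ : ℤ)) (γ : ℤ)) : (thetaCoeff q γ δ m : ℂ) = 0 := by
  rw [thetaCoeff_of_notMem q h, Complex.ofReal_zero]

theorem toeplitz_thetaSymbol (hq0 : q ≠ 0) (hq : |q| ≠ 1) (γ δ N : ℕ) :
    toeplitz (thetaSymbol q γ δ) N = (thetaToeplitz q γ δ N).map Complex.ofRealHom :=
  toeplitz_eq_toeplitzBlock (fun _ => thetaSymbol_eq_sum hq0 hq γ δ)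
    (ofReal_thetaCoeff_of_notMem q) N

theorem det_toeplitz_thetaSymbol (hq0 : q ≠ 0) (hq : |q| ≠ 1) (γ δ N : ℕ) :
    (toeplitz (thetaSymbol q γ δ) N).det = ((thetaToeplitz q γ δ N).det : ℂ) := by
  rw [toeplitz_thetaSymbol hq0 hq]
  exact (RingHom.map_det Complex.ofRealHom _).symm

theorem isUnit_det_toeplitz_thetaSymbol (hq0 : q ≠ 0) (hq : |q| ≠ 1) (γ δ N : ℕ) :
    IsUnit (toeplitz (thetaSymbol q γ δ) N).det := by
  rw [det_toeplitz_thetaSymbol hq0 hq]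
  exact (isUnit_det_thetaToeplitz hq0 hq γ δ N).map Complex.ofRealHom

theorem inv_toeplitz_thetaSymbol (hq0 : q ≠ 0) (hq : |q| ≠ 1) (γ δ N : ℕ) (a b : Fin (N + 1)) :
    (toeplitz (thetaSymbol q γ δ) (N + 1))⁻¹ a b = (thetaInv q γ δ N a b : ℂ) := by
  have h := congrArg (fun A => A.map Complex.ofRealHom)
    (Matrix.mul_nonsing_inv _ (isUnit_det_thetaToeplitz hq0 hq γ δ (N + 1)))
  simp only [Matrix.map_mul, Matrix.map_one _ (map_zero Complex.ofRealHom)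
    (map_one Complex.ofRealHom)] at h
  rw [toeplitz_thetaSymbol hq0 hq, Matrix.inv_eq_right_inv h, inv_thetaToeplitz hq0 hq]
  rfl

theorem biorthNorm_mul_self (q : ℝ) (γ δ n : ℕ) :
    biorthNorm q γ δ n * biorthNorm q γ δ n = ((biorthSq q γ δ n)⁻¹ : ℝ) := by
  rw [biorthNorm, ← pow_two, ← Complex.cpow_nat_mul, biorthSq, inv_div]
  norm_num

theorem biorthNorm_ne_zero (hq : |q| ≠ 1) (γ δ n : ℕ) : biorthNorm q γ δ n ≠ 0 := by
  refine left_ne_zero_of_mul (b := biorthNorm q γ δ n) ?_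
  rw [biorthNorm_mul_self]
  exact_mod_cast inv_ne_zero (biorthSq_ne_zero hq γ δ n)

theorem coeff_sum_range_monomial {R : Type*} [Semiring R] {n : ℕ} {c : ℕ → R}
    (hc : ∀ r, n < r → c r = 0) (r : ℕ) :
    (∑ i ∈ Finset.range (n + 1), Polynomial.monomial i (c i)).coeff r = c r := by
  simp only [Polynomial.finsetSum_coeff, Polynomial.coeff_monomial, Finset.sum_ite_eq',
    Finset.mem_range]
  split_ifs with h
  · rfl
  · rw [hc r (by omega)]

theorem coeff_biorthP (hq : |q| ≠ 1) (γ : ℕ) {δ : ℕ} (hδ : 1 ≤ δ) (n r : ℕ) :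
    (biorthP q γ δ n).coeff r = biorthNorm q γ δ n * (pCoeff q γ δ n r : ℂ) := by
  rw [← coeff_sum_range_monomial (c := fun r => biorthNorm q γ δ n * (pCoeff q γ δ n r : ℂ))
    (fun r hr => by rw [pCoeff_of_lt hq γ δ hr, Complex.ofReal_zero, mul_zero]) r]
  congr 1
  refine Finset.sum_congr rfl fun r hr => ?_
  have hr' := Finset.mem_range.1 hr
  obtain ⟨δ, rfl⟩ := Nat.exists_eq_add_of_le' hδ
  rw [pCoeff, qRising_succ_left hq, Nat.add_sub_cancel,
    show δ + 1 + n - r - 1 = δ + (n - r) by omega]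

theorem coeff_biorthQ (hq : |q| ≠ 1) {γ : ℕ} (hγ : 1 ≤ γ) (δ n r : ℕ) :
    (biorthQ q γ δ n).coeff r = biorthNorm q γ δ n * (qCoeff q γ δ n r : ℂ) := by
  rw [← coeff_sum_range_monomial (c := fun r => biorthNorm q γ δ n * (qCoeff q γ δ n r : ℂ))
    (fun r hr => by rw [qCoeff_of_lt hq γ δ hr, Complex.ofReal_zero, mul_zero]) r]
  congr 1
  refine Finset.sum_congr rfl fun r hr => ?_
  have hr' := Finset.mem_range.1 hr
  obtain ⟨γ, rfl⟩ := Nat.exists_eq_add_of_le' hγ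
  rw [qCoeff, pCoeff, qRising_succ_left hq, Nat.add_sub_cancel,
    show γ + 1 + n - r - 1 = γ + (n - r) by omega, mul_right_comm _ (_ / _) (_ / _)]

theorem natDegree_biorthP (hq : |q| ≠ 1) (γ : ℕ) {δ : ℕ} (hδ : 1 ≤ δ) (n : ℕ) :
    (biorthP q γ δ n).natDegree = n := by
  refine Polynomial.natDegree_eq_of_le_of_coeff_ne_zero ?_ ?_
  · refine Polynomial.natDegree_le_iff_coeff_eq_zero.2 fun r hr => ?_
    rw [coeff_biorthP hq γ hδ, pCoeff_of_lt hq γ δ hr, Complex.ofReal_zero, mul_zero]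
  · rw [coeff_biorthP hq γ hδ, pCoeff_self hq, Complex.ofReal_one, mul_one]
    exact biorthNorm_ne_zero hq γ δ n

theorem natDegree_biorthQ (hq : |q| ≠ 1) {γ : ℕ} (hγ : 1 ≤ γ) (δ n : ℕ) :
    (biorthQ q γ δ n).natDegree = n := by
  refine Polynomial.natDegree_eq_of_le_of_coeff_ne_zero ?_ ?_
  · refine Polynomial.natDegree_le_iff_coeff_eq_zero.2 fun r hr => ?_
    rw [coeff_biorthQ hq hγ, qCoeff_of_lt hq γ δ hr, Complex.ofReal_zero, mul_zero]
  · rw [coeff_biorthQ hq hγ, qCoeff_self hq, Complex.ofReal_one, mul_one]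
    exact biorthNorm_ne_zero hq γ δ n

theorem circleMean_biorthP_mul_biorthQ (hq0 : q ≠ 0) (hq : |q| ≠ 1) {γ δ : ℕ} (hγ : 1 ≤ γ)
    (hδ : 1 ≤ δ) (m n : ℕ) :
    circleMean (fun z => (biorthP q γ δ m).eval z * (biorthQ q γ δ n).eval z⁻¹
      * thetaSymbol q γ δ z) = if m = n then 1 else 0 := by
  rw [circleMean_eval_mul_eval_inv_mul (fun _ => thetaSymbol_eq_sum hq0 hq γ δ)
    (ofReal_thetaCoeff_of_notMem q), natDegree_biorthP hq γ hδ, natDegree_biorthQ hq hγ]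
  simp only [coeff_biorthP hq γ hδ, coeff_biorthQ hq hγ]
  calc ∑ s ∈ Finset.range (n + 1), ∑ r ∈ Finset.range (m + 1),
        biorthNorm q γ δ n * (qCoeff q γ δ n s : ℂ) * thetaCoeff q γ δ ((s : ℤ) - r) *
          (biorthNorm q γ δ m * pCoeff q γ δ m r)
      = biorthNorm q γ δ m * biorthNorm q γ δ n * ((∑ s ∈ Finset.range (n + 1),
          ∑ r ∈ Finset.range (m + 1), qCoeff q γ δ n s * thetaCoeff q γ δ ((s : ℤ) - r) *
            pCoeff q γ δ m r : ℝ) : ℂ) := by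
        push_cast
        simp only [Finset.mul_sum]
        exact Finset.sum_congr rfl fun s _ => Finset.sum_congr rfl fun r _ => by ring
    _ = if m = n then 1 else 0 := by
        rw [sum_qCoeff_mul_thetaCoeff_mul_pCoeff hq0 hq]
        split_ifs with hmn
        · rw [hmn, biorthNorm_mul_self, ← Complex.ofReal_mul,
            inv_mul_cancel₀ (biorthSq_ne_zero hq γ δ n), Complex.ofReal_one]
        · rw [Complex.ofReal_zero, mul_zero]

end ThetaSymbol

section CompleteHomogeneous

variable {α R : Type*} [Fintype α] [DecidableEq α]

theorem eval_hsymm [CommSemiring R] (x : α → R) (n : ℕ) :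
    MvPolynomial.eval x (MvPolynomial.hsymm α R n) = ∑ s : Sym α n, (s.1.map x).prod := by
  rw [MvPolynomial.hsymm, map_sum]
  refine Finset.sum_congr rfl fun s _ => ?_
  rw [map_multiset_prod, Multiset.map_map]
  simp

theorem eval_hsymm_option [CommSemiring R] (x : Option α → R) (n : ℕ) :
    MvPolynomial.eval x (MvPolynomial.hsymm (Option α) R (n + 1)) =
      x none * MvPolynomial.eval x (MvPolynomial.hsymm (Option α) R n) +
        MvPolynomial.eval (fun a => x (some a)) (MvPolynomial.hsymm α R (n + 1)) := by
  rw [eval_hsymm, eval_hsymm, eval_hsymm, ← (symOptionSuccEquiv (α := α) (n := n)).symm.sum_comp,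
    Fintype.sum_sum_type, Finset.mul_sum]
  congr 1
  · refine Finset.sum_congr rfl fun s _ => ?_
    change (Multiset.map x ↑(none ::ₛ s)).prod = _
    rw [Sym.coe_cons, Multiset.map_cons, Multiset.prod_cons]
    rfl
  · exact Finset.sum_congr rfl fun s _ => by simp [symOptionSuccEquiv]

/-- The generating function of the values of the complete homogeneous symmetric polynomials. -/
noncomputable def hSeries [CommSemiring R] (x : α → R) : PowerSeries R :=
  PowerSeries.mk fun n => MvPolynomial.eval x (MvPolynomial.hsymm α R n)

theorem coeff_hSeries [CommSemiring R] (x : α → R) (n : ℕ) :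
    PowerSeries.coeff n (hSeries x) = MvPolynomial.eval x (MvPolynomial.hsymm α R n) :=
  PowerSeries.coeff_mk _ _

theorem constantCoeff_hSeries [CommSemiring R] (x : α → R) :
    PowerSeries.constantCoeff (hSeries x) = 1 := by
  rw [← PowerSeries.coeff_zero_eq_constantCoeff_apply, coeff_hSeries, MvPolynomial.hsymm_zero,
    map_one]

theorem hSeries_comp_equiv [CommSemiring R] {β : Type*} [Fintype β] [DecidableEq β] (e : α ≃ β)
    (x : β → R) : hSeries (x ∘ e) = hSeries x := by
  ext n
  rw [coeff_hSeries, coeff_hSeries, ← MvPolynomial.rename_hsymm _ R n e, MvPolynomial.eval_rename]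

theorem one_sub_mul_hSeries_option [CommRing R] (x : Option α → R) :
    (1 - PowerSeries.C (x none) * PowerSeries.X) * hSeries x = hSeries fun a => x (some a) := by
  ext (_ | n)
  · simp [constantCoeff_hSeries]
  · rw [sub_mul, one_mul, mul_assoc, map_sub, PowerSeries.coeff_C_mul,
      PowerSeries.coeff_succ_X_mul, coeff_hSeries, coeff_hSeries, coeff_hSeries, eval_hsymm_option]
    ring

theorem prod_mul_hSeries [CommRing R] (x : α → R) :
    (∏ i, (1 - PowerSeries.C (x i) * PowerSeries.X)) * hSeries x = 1 := by
  revert x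
  refine Fintype.induction_empty_option (P := fun β _ => ∀ [DecidableEq β] (x : β → R),
    (∏ i, (1 - PowerSeries.C (x i) * PowerSeries.X)) * hSeries x = 1)
    (fun β β' _ e ih _ x => ?_) (fun x => ?_) (fun β _ ih _ x => ?_) α
  · classical
    let _ := Fintype.ofEquiv β' e.symm
    rw [← hSeries_comp_equiv e, ← e.prod_comp]
    exact ih (x ∘ e)
  · ext (_ | n)
    · simp [constantCoeff_hSeries]
    · simp [coeff_hSeries, eval_hsymm]
  · classical
    rw [Fintype.prod_option, mul_right_comm, mul_comm (_ * _)]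
    convert ih fun a => x (some a)
    convert one_sub_mul_hSeries_option x

end CompleteHomogeneous

section IntegerCoefficients

variable {R : Type*} [Semiring R]

/-- The coefficients of a power series, extended by zero to negative indices. -/
noncomputable def coeffInt (F : PowerSeries R) (m : ℤ) : R :=
  if 0 ≤ m then PowerSeries.coeff m.toNat F else 0

theorem coeffInt_natCast (F : PowerSeries R) (n : ℕ) :
    coeffInt F n = PowerSeries.coeff n F := by
  simp [coeffInt]

theorem coeffInt_of_neg (F : PowerSeries R) {m : ℤ} (h : m < 0) : coeffInt F m = 0 := by
  simp [coeffInt, not_le.2 h]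

theorem coeffInt_one (m : ℤ) : coeffInt (1 : PowerSeries R) m = if m = 0 then 1 else 0 := by
  rcases lt_or_ge m 0 with h | h
  · rw [coeffInt_of_neg _ h, if_neg h.ne]
  · lift m to ℕ using h
    simp [coeffInt_natCast, PowerSeries.coeff_one]

theorem toeplitzBlock_coeffInt_one (n : ℕ) :
    toeplitzBlock (coeffInt (1 : PowerSeries R)) 0 n n = 1 := by
  ext a b
  simp [toeplitzBlock_apply, coeffInt_one, Matrix.one_apply, sub_eq_zero, Fin.ext_iff]

theorem toeplitzBlock_coeffInt_one_of_le {d n : ℕ} (m : ℕ) (h : n ≤ d) :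
    toeplitzBlock (coeffInt (1 : PowerSeries R)) d m n = 0 := by
  ext a b
  rw [toeplitzBlock_apply, coeffInt_one, if_neg (by omega), Matrix.zero_apply]

theorem sum_coeffInt_mul (F G : PowerSeries R) {a n : ℕ} (b : ℕ) (ha : a < n) :
    ∑ c ∈ Finset.range n, coeffInt F ((a : ℤ) - c) * coeffInt G ((c : ℤ) - b) =
      coeffInt (F * G) ((a : ℤ) - b) := by
  rcases lt_or_ge a b with h | h
  · rw [coeffInt_of_neg (F * G) (by omega)]
    refine Finset.sum_eq_zero fun c _ => ?_
    rcases lt_or_ge a c with h1 | h1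
    · rw [coeffInt_of_neg F (by omega), zero_mul]
    · rw [coeffInt_of_neg G (by omega), mul_zero]
  · obtain ⟨l, rfl⟩ := Nat.exists_eq_add_of_le h
    have hl : ((b + l : ℕ) : ℤ) - b = l := by omega
    rw [← Finset.sum_subset (Finset.range_subset_range.2 (show b + (l + 1) ≤ n by omega)),
      Finset.sum_range_add, Finset.sum_eq_zero, zero_add, hl, coeffInt_natCast,
      PowerSeries.coeff_mul, ← Finset.Nat.sum_antidiagonal_swap,
      Finset.Nat.sum_antidiagonal_eq_sum_range_succ_mk]
    · refine Finset.sum_congr rfl fun j hj => ?_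
      have hjl := Finset.mem_range.1 hj
      rw [show ((b + l : ℕ) : ℤ) - (b + j : ℕ) = (l - j : ℕ) by omega,
        show ((b + j : ℕ) : ℤ) - b = j by omega, coeffInt_natCast, coeffInt_natCast]
      rfl
    · intro c hc
      have := Finset.mem_range.1 hc
      rw [coeffInt_of_neg G (by omega), mul_zero]
    · intro c _ hc
      rw [Finset.mem_range, not_lt] at hc
      rw [coeffInt_of_neg F (by omega), zero_mul]

theorem toeplitzBlock_coeffInt_mul_add_mul (F G : PowerSeries R) {s m n₁ n₂ : ℕ} (t p : ℕ)
    (h : s + m ≤ n₁ + n₂) :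
    toeplitzBlock (coeffInt F) s m n₁ * toeplitzBlock (coeffInt G) (-t) n₁ p +
        toeplitzBlock (coeffInt F) (s - n₁) m n₂ * toeplitzBlock (coeffInt G) (n₁ - t) n₂ p =
      toeplitzBlock (coeffInt (F * G)) (s - t) m p := by
  ext a b
  have hsum := sum_coeffInt_mul F G (a := s + a) (n := n₁ + n₂) (t + b) (by omega)
  rw [Finset.sum_range_add, ← Fin.sum_univ_eq_sum_range
      (fun c => coeffInt F ((s + a : ℕ) - c) * coeffInt G (c - (t + b : ℕ))),
    ← Fin.sum_univ_eq_sum_range (fun c => coeffInt F ((s + a : ℕ) - (n₁ + c : ℕ)) *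
      coeffInt G ((n₁ + c : ℕ) - (t + b : ℕ)))] at hsum
  rw [Matrix.add_apply, Matrix.mul_apply, Matrix.mul_apply, toeplitzBlock_apply,
    show (s - t + a - b : ℤ) = (s + a : ℕ) - (t + b : ℕ) by push_cast; ring, ← hsum]
  simp only [toeplitzBlock_apply]
  congr 1 <;> refine Finset.sum_congr rfl fun c _ => ?_ <;> congr 2 <;> push_cast <;> ring

end IntegerCoefficients

section ComplementaryMinors

variable {R : Type*}

theorem finRotate_pow_val (n m : ℕ) (i : Fin (n + 1)) :
    ((finRotate (n + 1) ^ m) i : ℕ) = (i + m) % (n + 1) := by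
  induction m with
  | zero => simp [Nat.mod_eq_of_lt i.2]
  | succ m ih =>
    rw [pow_succ', Equiv.Perm.mul_apply, finRotate_apply, Fin.val_add, ih, Fin.val_one',
      ← Nat.add_mod, add_assoc]

theorem sign_finRotate_pow (d N : ℕ) :
    Equiv.Perm.sign (finRotate (d + N + 1) ^ (N + 1)) = (-1) ^ (d * (N + 1)) := by
  rw [map_pow, sign_finRotate, Nat.add_sub_cancel, ← pow_mul, add_mul, pow_add,
    Even.neg_one_pow (Nat.even_mul_succ_self N), mul_one]

theorem fromBlocks_toeplitzBlock (h : ℤ → R) (N d : ℕ) :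
    Matrix.fromBlocks (toeplitzBlock h (N + 1 : ℕ) d d)
        (toeplitzBlock h ((N + 1 : ℕ) - d) d (N + 1))
        (toeplitzBlock h 0 (N + 1) d) (toeplitzBlock h (-d) (N + 1) (N + 1)) =
      ((toeplitzBlock h 0 (d + N + 1) (d + N + 1)).submatrix
        (finRotate (d + N + 1) ^ (N + 1)) id).submatrix
          (finSumFinEquiv (m := d) (n := N + 1)) (finSumFinEquiv (m := d) (n := N + 1)) := by
  have htop (a : Fin d) : ((a : ℕ) + (N + 1)) % (d + N + 1) = a + (N + 1) :=
    Nat.mod_eq_of_lt (by omega)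
  have hbot (a : Fin (N + 1)) : (d + (a : ℕ) + (N + 1)) % (d + N + 1) = a := by
    rw [show d + (a : ℕ) + (N + 1) = a + (d + N + 1) by ring, Nat.add_mod_right]
    exact Nat.mod_eq_of_lt (by omega)
  ext a b
  rw [Matrix.submatrix_apply, Matrix.submatrix_apply, toeplitzBlock_apply, finRotate_pow_val]
  rcases a with a | a <;> rcases b with b | b
  · rw [Matrix.fromBlocks_apply₁₁, toeplitzBlock_apply]
    congr 1
    simp only [finSumFinEquiv_apply_left, Fin.val_castAdd, htop, id_eq]
    push_cast
    ring
  · rw [Matrix.fromBlocks_apply₁₂, toeplitzBlock_apply]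
    congr 1
    simp only [finSumFinEquiv_apply_left, finSumFinEquiv_apply_right, Fin.val_castAdd,
      Fin.val_natAdd, htop, id_eq]
    push_cast
    ring
  · rw [Matrix.fromBlocks_apply₂₁, toeplitzBlock_apply]
    congr 1
    simp [hbot]
  · rw [Matrix.fromBlocks_apply₂₂, toeplitzBlock_apply]
    congr 1
    simp only [finSumFinEquiv_apply_right, Fin.val_natAdd, hbot, id_eq]
    push_cast
    ring

/-- The matrix `(h_{μ_a - ν_b - a + b})` of the skew shape `μ/ν = (N^d, j)/(k)`. -/
def skewMatrix (h : ℤ → R) (N d j k : ℕ) : Matrix (Fin (d + 1)) (Fin (d + 1)) R :=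
  Matrix.of fun a b => h ((if (a : ℕ) < d then N else j : ℕ) - (if (b : ℕ) = 0 then k else 0 : ℕ)
    - a + b)

/-- The enumeration `d - 1, …, 0, d` of `Fin (d + 1)`, which turns the rows of `skewMatrix` into
rows of the matrix `(h_{a-b})` in increasing order. -/
def revInit (d : ℕ) : Fin d ⊕ Unit ≃ Fin (d + 1) :=
  (Equiv.sumCongr Fin.revPerm (Equiv.ofUnique Unit (Fin 1))).trans finSumFinEquiv

theorem skewMatrix_submatrix (h : ℤ → R) (N d : ℕ) (j k : Fin (N + 1)) :
    ((skewMatrix h N d j k).submatrix id (finRotate (d + 1))).submatrix (revInit d) (revInit d) =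
      Matrix.fromBlocks (toeplitzBlock h (N + 1 : ℕ) d d)
        ((toeplitzBlock h ((N + 1 : ℕ) - d) d (N + 1)).submatrix id fun _ => k)
        ((toeplitzBlock h 0 (N + 1) d).submatrix (fun _ => j) id)
        ((toeplitzBlock h (-d) (N + 1) (N + 1)).submatrix (fun _ => j) fun _ => k) := by
  have hrow (i : Fin d) : (revInit d (Sum.inl i) : ℕ) = d - (i + 1) := by simp [revInit]
  have hrow_last : (revInit d (Sum.inr ()) : ℕ) = d := by simp [revInit]
  have hcol (i : Fin d) : (finRotate (d + 1) (revInit d (Sum.inl i)) : ℕ) = d - i := by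
    rw [← pow_one (finRotate _), finRotate_pow_val, hrow, Nat.mod_eq_of_lt (by omega)]
    omega
  have hcol_last : (finRotate (d + 1) (revInit d (Sum.inr ())) : ℕ) = 0 := by
    rw [← pow_one (finRotate _), finRotate_pow_val, hrow_last, Nat.mod_self]
  ext a b
  simp only [Matrix.submatrix_apply, skewMatrix, Matrix.of_apply, id_eq]
  rcases a with a | a <;> rcases b with b | b
  · rw [hrow, hcol, if_pos (by omega), if_neg (by omega), Matrix.fromBlocks_apply₁₁,
      toeplitzBlock_apply]
    congr 1
    omega
  · rw [hrow, hcol_last, if_pos (by omega), if_pos rfl, Matrix.fromBlocks_apply₁₂,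
      Matrix.submatrix_apply, toeplitzBlock_apply]
    congr 1
    simp only [id_eq]
    omega
  · rw [hrow_last, hcol, if_neg (by omega), if_neg (by omega), Matrix.fromBlocks_apply₂₁,
      Matrix.submatrix_apply, toeplitzBlock_apply]
    congr 1
    simp only [id_eq]
    omega
  · rw [hrow_last, hcol_last, if_neg (by omega), if_pos rfl, Matrix.fromBlocks_apply₂₂,
      Matrix.submatrix_apply, toeplitzBlock_apply]
    congr 1
    omega

variable [CommRing R]

theorem det_fromBlocks_submatrix_of_mul_add_mul {m n l : Type*} [Fintype m] [DecidableEq m]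
    [Fintype n] [DecidableEq n] [Fintype l] [DecidableEq l] {T Y : Matrix m m R}
    {E X : Matrix m n R} {Z : Matrix n n R} {W : Matrix n m R} (hT : IsUnit T.det)
    (hX : T * X + E * Z = 0) (hY : T * Y + E * W = 1) (r c : l → m) :
    (Matrix.fromBlocks Z (W.submatrix id c) (X.submatrix r id) (Y.submatrix r c)).det =
      Z.det * (T⁻¹.submatrix r c).det := by
  have hXV : T⁻¹ * E * Z + X = 0 := by
    have := congrArg (T⁻¹ * ·) hX
    simpa [Matrix.mul_add, ← Matrix.mul_assoc, Matrix.nonsing_inv_mul _ hT, add_comm] using this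
  have hYV : T⁻¹ * E * W + Y = T⁻¹ := by
    have := congrArg (T⁻¹ * ·) hY
    simpa [Matrix.mul_add, ← Matrix.mul_assoc, Matrix.nonsing_inv_mul _ hT, add_comm] using this
  have hmul : Matrix.fromBlocks 1 0 ((T⁻¹ * E).submatrix r id) 1 *
      Matrix.fromBlocks Z (W.submatrix id c) (X.submatrix r id) (Y.submatrix r c) =
      Matrix.fromBlocks Z (W.submatrix id c) 0 (T⁻¹.submatrix r c) := by
    rw [Matrix.fromBlocks_multiply, Matrix.zero_mul, Matrix.zero_mul, add_zero, add_zero,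
      Matrix.one_mul, Matrix.one_mul, Matrix.one_mul, Matrix.one_mul]
    congr 1
    · exact congrArg (fun A => A.submatrix r id) hXV
    · exact congrArg (fun A => A.submatrix r c) hYV
  have hdet := congrArg Matrix.det hmul
  rwa [Matrix.det_mul, Matrix.det_fromBlocks_zero₁₂, Matrix.det_fromBlocks_zero₂₁, Matrix.det_one,
    Matrix.det_one, one_mul, one_mul] at hdet

theorem det_toeplitzBlock_of_neg {h : ℤ → R} (hneg : ∀ m, m < 0 → h m = 0) (h0 : h 0 = 1)
    (n : ℕ) : (toeplitzBlock h 0 n n).det = 1 := by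
  have hlower : (toeplitzBlock h 0 n n).IsLowerTriangular := fun a b hab => hneg _ (by
    have : (a : ℕ) < b := hab
    omega)
  rw [Matrix.det_of_isLowerTriangular _ hlower]
  exact Finset.prod_eq_one fun a _ => by simp [toeplitzBlock_apply, h0]

theorem det_fromBlocks_toeplitzBlock {h : ℤ → R} (hneg : ∀ m, m < 0 → h m = 0) (h0 : h 0 = 1)
    (N d : ℕ) :
    (Matrix.fromBlocks (toeplitzBlock h (N + 1 : ℕ) d d)
      (toeplitzBlock h ((N + 1 : ℕ) - d) d (N + 1))
      (toeplitzBlock h 0 (N + 1) d) (toeplitzBlock h (-d) (N + 1) (N + 1))).det =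
        (-1) ^ (d * (N + 1)) := by
  rw [fromBlocks_toeplitzBlock, Matrix.det_submatrix_equiv_self, Matrix.det_permute,
    det_toeplitzBlock_of_neg hneg h0, mul_one, sign_finRotate_pow]
  simp

theorem det_skewMatrix {E H : PowerSeries R} (hEH : E * H = 1)
    (hH : PowerSeries.constantCoeff H = 1) (N d : ℕ)
    (hT : IsUnit (toeplitzBlock (coeffInt E) d (N + 1) (N + 1)).det) (j k : Fin (N + 1)) :
    (skewMatrix (coeffInt H) N d j k).det =
      (-1) ^ (d * N) * (toeplitzBlock (coeffInt E) d (N + 1) (N + 1)).det *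
        (toeplitzBlock (coeffInt E) d (N + 1) (N + 1))⁻¹ j k := by
  set T := toeplitzBlock (coeffInt E) d (N + 1) (N + 1)
  have hX := toeplitzBlock_coeffInt_mul_add_mul E H 0 d
    (show d + (N + 1) ≤ (N + 1) + d by omega)
  have hY := toeplitzBlock_coeffInt_mul_add_mul E H d (N + 1)
    (show d + (N + 1) ≤ (N + 1) + d by omega)
  simp only [hEH, Nat.cast_zero, neg_zero, sub_zero,
    toeplitzBlock_coeffInt_one_of_le (N + 1) le_rfl] at hX
  rw [hEH, sub_self, toeplitzBlock_coeffInt_one] at hY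
  have hneg (m : ℤ) (hm : m < 0) : coeffInt H m = 0 := coeffInt_of_neg H hm
  have h0 : coeffInt H 0 = 1 := by simpa [hH] using coeffInt_natCast H 0
  have hfull := det_fromBlocks_submatrix_of_mul_add_mul hT hX hY id id
  have hminor := det_fromBlocks_submatrix_of_mul_add_mul (l := Unit) hT hX hY (fun _ => j)
    (fun _ => k)
  rw [← skewMatrix_submatrix, Matrix.det_submatrix_equiv_self, Matrix.det_permute', sign_finRotate,
    Nat.add_sub_cancel, Matrix.det_unique (T⁻¹.submatrix _ _), Matrix.submatrix_apply] at hminor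
  rw [Matrix.submatrix_id_id, Matrix.submatrix_id_id, Matrix.submatrix_id_id,
    Matrix.submatrix_id_id, det_fromBlocks_toeplitzBlock hneg h0] at hfull
  have hTdet : T⁻¹.det * T.det = 1 := Matrix.det_nonsing_inv_mul_det T hT
  have hsq : (-1 : R) ^ d * (-1) ^ d = 1 := by rw [← mul_pow, neg_one_mul, neg_neg, one_pow]
  have hsign : (-1 : R) ^ (d * (N + 1)) = (-1) ^ (d * N) * (-1) ^ d := by
    rw [mul_add, mul_one, pow_add]
  set Z := (toeplitzBlock (coeffInt H) (N + 1 : ℕ) d d).det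
  set S := (skewMatrix (coeffInt H) N d j k).det
  push_cast at hminor
  calc S = (-1) ^ d * ((-1) ^ d * S) := by rw [← mul_assoc, hsq, one_mul]
    _ = (-1) ^ d * (Z * (T⁻¹.det * T.det)) * T⁻¹ j k := by rw [hminor, hTdet]; ring
    _ = (-1) ^ d * (-1) ^ (d * (N + 1)) * T.det * T⁻¹ j k := by rw [hfull]; ring
    _ = (-1) ^ (d * N) * T.det * T⁻¹ j k := by
      rw [hsign, mul_left_comm, hsq, mul_one]

end ComplementaryMinors

section Rescaling

variable {K : Type*} [Field K]

theorem inv_diagonal_pow {u : K} (hu : u ≠ 0) (n : ℕ) :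
    (Matrix.diagonal fun a : Fin n => u ^ (a : ℕ))⁻¹ =
      Matrix.diagonal fun a : Fin n => (u ^ (a : ℕ))⁻¹ := by
  refine Matrix.inv_eq_right_inv ?_
  rw [Matrix.diagonal_mul_diagonal, ← Matrix.diagonal_one]
  exact congrArg Matrix.diagonal (funext fun a => mul_inv_cancel₀ (pow_ne_zero _ hu))

variable {e t : ℤ → K} {s : ℤ} {c u : K}

theorem toeplitzBlock_eq_smul_conj (hu : u ≠ 0) (het : ∀ m, e (s + m) = c * u ^ m * t m) (n : ℕ) :
    toeplitzBlock e s n n = c • (Matrix.diagonal (fun a : Fin n => u ^ (a : ℕ)) *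
      toeplitzBlock t 0 n n * (Matrix.diagonal fun a : Fin n => u ^ (a : ℕ))⁻¹) := by
  ext a b
  rw [inv_diagonal_pow hu, Matrix.smul_apply, Matrix.mul_diagonal, Matrix.diagonal_mul,
    toeplitzBlock_apply, toeplitzBlock_apply, add_sub_assoc, het, zero_add, zpow_sub₀ hu,
    zpow_natCast, zpow_natCast, smul_eq_mul]
  ring

theorem isUnit_diagonal_pow (hu : u ≠ 0) (n : ℕ) :
    IsUnit (Matrix.diagonal fun a : Fin n => u ^ (a : ℕ)) :=
  Matrix.isUnit_diagonal.2 (Pi.isUnit_iff.2 fun _ => (pow_ne_zero _ hu).isUnit)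

theorem det_toeplitzBlock_rescale (hu : u ≠ 0) (het : ∀ m, e (s + m) = c * u ^ m * t m) (n : ℕ) :
    (toeplitzBlock e s n n).det = c ^ n * (toeplitzBlock t 0 n n).det := by
  rw [toeplitzBlock_eq_smul_conj hu het, Matrix.det_smul, Fintype.card_fin,
    Matrix.det_conj (isUnit_diagonal_pow hu n)]

theorem inv_toeplitzBlock_rescale (hc : c ≠ 0) (hu : u ≠ 0)
    (het : ∀ m, e (s + m) = c * u ^ m * t m) {n : ℕ} (ht : IsUnit (toeplitzBlock t 0 n n).det)
    (j k : Fin n) :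
    (toeplitzBlock e s n n)⁻¹ j k =
      c⁻¹ * u ^ ((j : ℤ) - k) * (toeplitzBlock t 0 n n)⁻¹ j k := by
  have hD := isUnit_diagonal_pow hu n
  have hsmul := Matrix.inv_smul' (A := _ * toeplitzBlock t 0 n n * _) (Units.mk0 c hc)
    (by rwa [Matrix.det_conj hD])
  rw [Units.smul_mk0] at hsmul
  rw [toeplitzBlock_eq_smul_conj hu het, hsmul, Matrix.mul_inv_rev, Matrix.mul_inv_rev,
    Matrix.nonsing_inv_nonsing_inv _ ((Matrix.isUnit_iff_isUnit_det _).1 hD), inv_diagonal_pow hu,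
    ← mul_assoc, Matrix.smul_apply, Matrix.mul_diagonal, Matrix.diagonal_mul, zpow_sub₀ hu,
    zpow_natCast, zpow_natCast, Units.smul_def, Units.val_inv_eq_inv_val, Units.val_mk0,
    smul_eq_mul]
  ring

end Rescaling

section PrincipalSpecialization

variable {q : ℝ}

/-- The generating function `∑ (-1)^n e_n(1, q, …, q^{M-1}) X^n` of the elementary symmetric
polynomials at the principal specialization. -/
noncomputable def eSeries (q : ℝ) (M : ℕ) : PowerSeries ℝ :=
  ∏ i : Fin M, (1 - PowerSeries.C (q ^ (i : ℕ)) * PowerSeries.X)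

theorem eSeries_mul_hSeries (q : ℝ) (M : ℕ) :
    eSeries q M * hSeries (fun i : Fin M => q ^ (i : ℕ)) = 1 :=
  prod_mul_hSeries _

theorem coeff_eSeries (hq0 : q ≠ 0) (hq : |q| ≠ 1) (M k : ℕ) :
    PowerSeries.coeff k (eSeries q M) = (-1) ^ k * qBinom q M k * q ^ (k.choose 2) := by
  have hcoe : eSeries q M =
      ((∏ i ∈ Finset.range M, (1 - Polynomial.C (q ^ i) * Polynomial.X) : Polynomial ℝ) :
        PowerSeries ℝ) := by
    rw [eSeries, Fin.prod_univ_eq_prod_range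
      (fun i => 1 - PowerSeries.C (q ^ i) * (PowerSeries.X : PowerSeries ℝ)),
      ← Polynomial.coeToPowerSeries.ringHom_apply]
    simp [map_prod]
  rw [hcoe, prod_one_sub_C_pow_mul_X hq0 hq, Polynomial.coeff_coe, Polynomial.finsetSum_coeff]
  simp only [Polynomial.coeff_C_mul_X_pow]
  rw [Finset.sum_ite_eq]
  split_ifs with hk
  · rfl
  · rw [qBinom_natCast_of_lt hq (by simpa using hk), mul_zero, zero_mul]

theorem pow_choose_two_mul_self (hq0 : q ≠ 0) (d : ℕ) :
    q ^ (d.choose 2) * q ^ (d.choose 2) = (q ^ ((d : ℤ) - 1)) ^ d := by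
  have h : (d.choose 2 : ℤ) + d.choose 2 = ((d : ℤ) - 1) * d := by
    qify
    rw [Nat.cast_choose_two]
    ring
  rw [← zpow_natCast, ← zpow_natCast, ← zpow_add₀ hq0, h, zpow_mul]

theorem coeffInt_eSeries (hq0 : q ≠ 0) (hq : |q| ≠ 1) {d M : ℕ} (hM : d ≤ M) (m : ℤ) :
    coeffInt (eSeries q M) (d + m) = ((-1) ^ d * q ^ (d.choose 2)) *
      (-q ^ ((d : ℤ) - 1)) ^ m * thetaCoeff q (M - d) d m := by
  rcases lt_or_ge ((d : ℤ) + m) 0 with h | h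
  · rw [coeffInt_of_neg _ h, thetaCoeff, qPochInv_of_neg q h, mul_zero, zero_mul, zero_mul,
      mul_zero]
  obtain ⟨k, hk⟩ := Int.eq_ofNat_of_zero_le h
  obtain rfl : m = k - d := by omega
  set v := q ^ ((d : ℤ) - 1) with hv
  have hv0 : v ≠ 0 := zpow_ne_zero _ hq0
  have hscale : q * q⁻¹ ^ d = v⁻¹ := by
    rw [hv, zpow_sub_one₀ hq0, zpow_natCast, inv_pow, mul_inv, inv_inv, mul_comm]
  rw [hk, coeffInt_natCast, coeff_eSeries hq0 hq, thetaCoeff_natCast_sub hq0 hq, hscale,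
    Nat.add_sub_cancel' hM, zpow_sub₀ (neg_ne_zero.2 hv0), zpow_natCast, zpow_natCast,
    neg_pow v k, neg_pow v d, inv_pow]
  calc (-1) ^ k * qBinom q M k * q ^ k.choose 2
      = (-1) ^ d * ((-1) ^ d)⁻¹ * (v ^ d * (v ^ d)⁻¹) * (v ^ k * (v ^ k)⁻¹) *
          ((-1) ^ k * qBinom q M k * q ^ k.choose 2) := by
        rw [mul_inv_cancel₀ (pow_ne_zero _ (by norm_num)), mul_inv_cancel₀ (pow_ne_zero _ hv0),
          mul_inv_cancel₀ (pow_ne_zero _ hv0), one_mul, one_mul, one_mul]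
    _ = _ := by
        nth_rewrite 1 [← pow_choose_two_mul_self hq0 d]
        ring

theorem eval_hsymmInt {M : ℕ} (x : Fin M → ℝ) (m : ℤ) :
    MvPolynomial.eval x (hsymmInt M m) = coeffInt (hSeries x) m := by
  rw [hsymmInt, coeffInt]
  split_ifs
  · rw [coeff_hSeries]
  · rw [map_zero]

theorem skewSpec_eq_det_skewMatrix (q : ℝ) (N d j k M : ℕ) :
    skewSpec q N d j k M =
      (skewMatrix (coeffInt (hSeries fun i : Fin M => q ^ (i : ℕ))) N d j k).det := by
  have hlen : d + 1 = max (List.replicate d N ++ [j]).length [k].length := by simp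
  have hμ (a : Fin (d + 1)) :
      (List.replicate d N ++ [j]).getD a 0 = if (a : ℕ) < d then N else j := by
    split_ifs with ha
    · rw [List.getD_append _ _ _ _ (by simpa using ha), List.getD_replicate _ ha]
    · simp [show (a : ℕ) = d by omega, List.getD]
  have hν (b : Fin (d + 1)) : [k].getD b 0 = if (b : ℕ) = 0 then k else 0 := by
    cases (b : ℕ) <;> simp
  rw [skewSpec, skewSchur, RingHom.map_det, ← Matrix.det_submatrix_equiv_self (finCongr hlen)]
  congr 1
  ext a b
  simp only [Matrix.submatrix_apply, RingHom.mapMatrix_apply, Matrix.map_apply, Matrix.of_apply,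
    eval_hsymmInt, finCongr_apply, Fin.val_cast, hμ, hν, skewMatrix]

theorem thetaInv_eq_mul_sum (hq0 : q ≠ 0) {d M : ℕ} (hM : d ≤ M) (N j k : ℕ) :
    thetaInv q (M - d) d N j k = ((-1) ^ (j + k) * (q ^ k)⁻¹) *
      ∑ r ∈ Finset.Icc (max j k) N, q ^ r *
        ((qGamma q (M - d + j + 1) * qGamma q (d + k + 1) * qGamma q (r + 1)) /
          (qGamma q (j + 1) * qGamma q (k + 1) * qGamma q (M + r + 1))) *
        qBinom q ((M : ℤ) - d + r - k - 1) (r - k) *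
        qBinom q ((d : ℤ) + r - j - 1) (r - j) := by
  rw [thetaInv, Finset.mul_sum]
  refine Finset.sum_congr rfl fun r hr => ?_
  have hkr : k ≤ r := (le_max_right _ _).trans (Finset.mem_Icc.1 hr).1
  rw [Nat.add_sub_cancel' hM, Nat.cast_sub hM, pow_sub₀ q hq0 hkr]
  ring

theorem rescaling_factor_eq (hq0 : q ≠ 0) (N d j k : ℕ) :
    (-1 : ℝ) ^ (d * N) * ((-1) ^ d * q ^ (d.choose 2)) ^ N *
        (-q ^ ((d : ℤ) - 1)) ^ ((j : ℤ) - k) * ((-1) ^ (j + k) * (q ^ k)⁻¹) =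
      q ^ (((d : ℤ) - 1) * j - d * k + (d : ℤ) * ((d : ℤ) - 1) * N / 2) := by
  have htri : (d : ℤ) * ((d : ℤ) - 1) * N / 2 = (d.choose 2 * N : ℕ) := by
    refine Int.ediv_eq_of_eq_mul_left two_ne_zero ?_
    qify
    rw [Nat.cast_choose_two]
    ring
  have hexp : ((d : ℤ) - 1) * j - d * k + (d.choose 2 * N : ℕ) =
      (d.choose 2 * N : ℕ) + ((d : ℤ) - 1) * ((j : ℤ) - k) - k := by ring
  rw [htri, hexp, zpow_sub₀ hq0 _ (k : ℤ), zpow_add₀ hq0, zpow_mul q ((d : ℤ) - 1), zpow_natCast,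
    zpow_natCast, pow_mul, pow_mul]
  set v := q ^ ((d : ℤ) - 1)
  have hsq (n : ℕ) : (-1 : ℝ) ^ n * (-1) ^ n = 1 := by
    rw [← mul_pow, neg_one_mul, neg_neg, one_pow]
  have hneg : (-v) ^ ((j : ℤ) - k) = (-1) ^ (j + k) * v ^ ((j : ℤ) - k) := by
    rw [neg_eq_neg_one_mul, mul_zpow, zpow_sub₀ (by norm_num), zpow_natCast, zpow_natCast,
      pow_add, div_eq_mul_inv, ← inv_pow, inv_neg_one]
  rw [hneg, mul_pow]
  calc _ = (((-1) ^ d) ^ N * ((-1) ^ d) ^ N) * ((-1) ^ (j + k) * (-1) ^ (j + k)) *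
        ((q ^ d.choose 2) ^ N * v ^ ((j : ℤ) - k) / q ^ k) := by ring
    _ = _ := by rw [← pow_mul, hsq, hsq, one_mul, one_mul]

theorem skewSpec_eq_qFormula (hq0 : q ≠ 0) (hq : |q| ≠ 1) {N d j k M : ℕ} (hj : j ≤ N)
    (hk : k ≤ N) (hM : d ≤ M) : skewSpec q N d j k M = qFormula q N d j k M := by
  set c : ℝ := (-1) ^ d * q ^ (d.choose 2)
  set u : ℝ := -q ^ ((d : ℤ) - 1)
  have hc : c ≠ 0 := mul_ne_zero (pow_ne_zero _ (by norm_num)) (pow_ne_zero _ hq0)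
  have hu : u ≠ 0 := neg_ne_zero.2 (zpow_ne_zero _ hq0)
  have hscale := coeffInt_eSeries hq0 hq hM
  have hT := isUnit_det_thetaToeplitz hq0 hq (M - d) d (N + 1)
  have hdet := det_toeplitzBlock_rescale hu hscale (N + 1)
  have hinv := inv_toeplitzBlock_rescale hc hu hscale hT ⟨j, by omega⟩ ⟨k, by omega⟩
  have hunit : IsUnit (toeplitzBlock (coeffInt (eSeries q M)) d (N + 1) (N + 1)).det := by
    rw [hdet]
    exact ((hc.isUnit).pow _).mul hT
  have hskew := det_skewMatrix (eSeries_mul_hSeries q M) (constantCoeff_hSeries _) N d hunit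
    ⟨j, by omega⟩ ⟨k, by omega⟩
  rw [skewSpec_eq_det_skewMatrix, hskew, hdet, hinv, inv_thetaToeplitz hq0 hq,
    det_thetaToeplitz hq0 hq, Matrix.of_apply, thetaInv_eq_mul_sum hq0 hM, qFormula,
    ← rescaling_factor_eq hq0, Nat.add_sub_cancel' hM]
  have hcancel : c ^ (N + 1) * c⁻¹ = c ^ N := by rw [pow_succ, mul_inv_cancel_right₀ hc]
  rw [← hcancel]
  simp only [← add_assoc]
  ring

end PrincipalSpecialization

section ClassicalLimit

theorem tendsto_qNumber (n : ℕ) :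
    Filter.Tendsto (fun q : ℝ => (1 - q ^ n) / (1 - q)) (𝓝[≠] 1) (𝓝 n) := by
  have hcont : Continuous fun q : ℝ => ∑ i ∈ Finset.range n, q ^ i := by fun_prop
  have hsum : Filter.Tendsto (fun q : ℝ => ∑ i ∈ Finset.range n, q ^ i) (𝓝[≠] 1) (𝓝 n) := by
    simpa using (hcont.tendsto 1).mono_left (nhdsWithin_le_nhds (s := {1}ᶜ))
  refine hsum.congr' ?_
  filter_upwards [self_mem_nhdsWithin] with q hq
  rw [eq_div_iff (sub_ne_zero.2 (Ne.symm hq)), geom_sum_mul_neg]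

theorem tendsto_qGamma_succ (k : ℕ) :
    Filter.Tendsto (fun q : ℝ => qGamma q (k + 1)) (𝓝[≠] 1) (𝓝 (Real.Gamma (k + 1))) := by
  have hlim := tendsto_finsetProd (Finset.Icc 1 k) fun i _ => tendsto_qNumber i
  rw [← Nat.cast_prod, ← Finset.Ico_add_one_right_eq_Icc, Finset.prod_Ico_id_eq_factorial,
    ← Real.Gamma_nat_eq_factorial] at hlim
  refine hlim.congr fun q => ?_
  rw [Finset.prod_div_distrib, qGamma_succ, qPoch, Finset.Ico_add_one_right_eq_Icc,
    Finset.prod_const, Nat.card_Icc, Nat.add_sub_cancel]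

theorem gamma_natCast_add_one_ne_zero (k : ℕ) : Real.Gamma (k + 1) ≠ 0 :=
  (Real.Gamma_pos_of_pos (by positivity)).ne'

theorem barnesG_succ_ne_zero (k : ℕ) : barnesG (k + 1) ≠ 0 :=
  Finset.prod_ne_zero_iff.2 fun i _ => gamma_natCast_add_one_ne_zero i

theorem tendsto_qBarnes_succ (k : ℕ) :
    Filter.Tendsto (fun q : ℝ => qBarnes q (k + 1)) (𝓝[≠] 1) (𝓝 (barnesG (k + 1))) :=
  tendsto_finsetProd _ fun i _ => tendsto_qGamma_succ i

theorem tendsto_qBarnes_div (k n : ℕ) :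
    Filter.Tendsto (fun q : ℝ => qBarnes q (k + 1) / qBarnes q (n + 1)) (𝓝[≠] 1)
      (𝓝 (barnesG (k + 1) / barnesG (n + 1))) :=
  (tendsto_qBarnes_succ k).div (tendsto_qBarnes_succ n) (barnesG_succ_ne_zero n)

theorem ringChoose_add_sub_one (c m : ℕ) :
    Ring.choose ((c : ℝ) + m - 1) m =
      (∏ i ∈ Finset.range m, ((c + i : ℕ) : ℝ)) / Real.Gamma (m + 1) := by
  rw [eq_div_iff (gamma_natCast_add_one_ne_zero m), ← Ring.multichoose_eq,
    Real.Gamma_nat_eq_factorial, mul_comm, ← nsmul_eq_mul,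
    Ring.factorial_nsmul_multichoose_eq_ascPochhammer, Polynomial.ascPochhammer_smeval_eq_eval]
  induction m with
  | zero => simp
  | succ m ih => rw [ascPochhammer_succ_eval, ih, Finset.prod_range_succ, Nat.cast_add c m]

theorem tendsto_qBinom_add_sub_one (c m : ℕ) :
    Filter.Tendsto (fun q : ℝ => qBinom q ((c : ℤ) + m - 1) m) (𝓝[≠] 1)
      (𝓝 (Ring.choose ((c : ℝ) + m - 1) m)) := by
  rw [ringChoose_add_sub_one]
  have hlim := (tendsto_finsetProd (Finset.range m) fun i _ => tendsto_qNumber (c + i)).div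
    (tendsto_qGamma_succ m) (gamma_natCast_add_one_ne_zero m)
  refine hlim.congr' ?_
  filter_upwards [self_mem_nhdsWithin] with q hq
  have hpow : (1 - q) ^ m ≠ 0 := pow_ne_zero _ (sub_ne_zero.2 (Ne.symm hq))
  rw [qBinom_add_sub_one, Pi.div_apply, Finset.prod_div_distrib, Finset.prod_const,
    Finset.card_range, qGamma_succ, div_div_div_cancel_right₀ hpow, qRising]

theorem tendsto_zpow_nhdsNE_one (z : ℤ) :
    Filter.Tendsto (fun q : ℝ => q ^ z) (𝓝[≠] 1) (𝓝 1) := by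
  simpa using (continuousAt_zpow₀ (1 : ℝ) z (Or.inl one_ne_zero)).tendsto.mono_left
    (nhdsWithin_le_nhds (s := {1}ᶜ))

theorem tendsto_qFormula_summand {d j k M r : ℕ} (hM : d ≤ M) (hj : j ≤ r) (hk : k ≤ r) :
    Filter.Tendsto (fun q : ℝ => q ^ r
      * ((qGamma q (M - d + j + 1) * qGamma q (d + k + 1) * qGamma q (r + 1))
        / (qGamma q (j + 1) * qGamma q (k + 1) * qGamma q (M + r + 1)))
      * qBinom q ((M : ℤ) - d + r - k - 1) (r - k)
      * qBinom q ((d : ℤ) + r - j - 1) (r - j)) (𝓝[≠] 1)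
      (𝓝 ((Real.Gamma ((M : ℝ) - d + j + 1) * Real.Gamma ((d : ℝ) + k + 1) *
          Real.Gamma ((r : ℝ) + 1)) / (Real.Gamma ((j : ℝ) + 1) * Real.Gamma ((k : ℝ) + 1) *
          Real.Gamma ((M : ℝ) + r + 1))
        * Ring.choose (((M : ℤ) : ℝ) - d + r - k - 1) (r - k)
        * Ring.choose (((d : ℤ) : ℝ) + r - j - 1) (r - j))) := by
  have hΓ := gamma_natCast_add_one_ne_zero
  have hpow := tendsto_zpow_nhdsNE_one r
  have hgamma := (((tendsto_qGamma_succ (M - d + j)).mul (tendsto_qGamma_succ (d + k))).mul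
    (tendsto_qGamma_succ r)).div (((tendsto_qGamma_succ j).mul (tendsto_qGamma_succ k)).mul
      (tendsto_qGamma_succ (M + r))) (mul_ne_zero (mul_ne_zero (hΓ j) (hΓ k)) (hΓ (M + r)))
  have hbinom₁ := tendsto_qBinom_add_sub_one (M - d) (r - k)
  have hbinom₂ := tendsto_qBinom_add_sub_one d (r - j)
  have hlim := ((hpow.mul hgamma).mul hbinom₁).mul hbinom₂
  push_cast [hM, hj, hk, ← add_sub_assoc] at hlim
  simpa only [one_mul, zpow_natCast, Int.cast_natCast, Pi.div_apply] using hlim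

theorem classicalFormula_eq_mul_sum (N d j k M : ℕ) :
    classicalFormula N d j k M = barnesG (N + 2)
      * (barnesG (M + N + 2) / barnesG (M + 1))
      * (barnesG (M - d + 1) / barnesG (M - d + N + 2))
      * (barnesG (d + 1) / barnesG (d + N + 2)) *
      ∑ r ∈ Finset.Icc (max j k) N,
        (Real.Gamma ((M : ℝ) - d + j + 1) * Real.Gamma ((d : ℝ) + k + 1) *
          Real.Gamma ((r : ℝ) + 1)) / (Real.Gamma ((j : ℝ) + 1) * Real.Gamma ((k : ℝ) + 1) *
          Real.Gamma ((M : ℝ) + r + 1))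
        * Ring.choose (((M : ℤ) : ℝ) - d + r - k - 1) (r - k)
        * Ring.choose (((d : ℤ) : ℝ) + r - j - 1) (r - j) := by
  rw [classicalFormula, mul_assoc, mul_assoc]
  congr 1
  rw [Finset.mul_sum, Finset.mul_sum]
  exact Finset.sum_congr rfl fun r _ => by ring

theorem tendsto_qFormula (N j k : ℕ) {d M : ℕ} (hM : d ≤ M) :
    Filter.Tendsto (fun q : ℝ => qFormula q N d j k M) (𝓝[≠] 1)
      (𝓝 (classicalFormula N d j k M)) := by
  have hpow := tendsto_zpow_nhdsNE_one (((d : ℤ) - 1) * j - d * k + (d : ℤ) * ((d : ℤ) - 1) * N / 2)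
  have hbarnes := (((tendsto_qBarnes_succ (N + 1)).mul (tendsto_qBarnes_div (M + N + 1) M)).mul
    (tendsto_qBarnes_div (M - d) (M - d + N + 1))).mul (tendsto_qBarnes_div d (d + N + 1))
  have hsum := tendsto_finsetSum (Finset.Icc (max j k) N) fun r hr =>
    have hr' := max_le_iff.1 (Finset.mem_Icc.1 hr).1
    tendsto_qFormula_summand hM hr'.1 hr'.2
  have hlim := (hpow.mul hbarnes).mul hsum
  rw [one_mul] at hlim
  rw [classicalFormula_eq_mul_sum]
  exact hlim

theorem continuous_skewSpec (N d j k M : ℕ) : Continuous fun q : ℝ => skewSpec q N d j k M := by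
  simp only [skewSpec, MvPolynomial.eval_eq]
  fun_prop

theorem skewSpec_one_eq_classicalFormula {N d j k M : ℕ} (hj : j ≤ N) (hk : k ≤ N) (hM : d ≤ M) :
    skewSpec 1 N d j k M = classicalFormula N d j k M := by
  have hlim := ((continuous_skewSpec N d j k M).tendsto 1).mono_left
    (nhdsWithin_le_nhds (s := {1}ᶜ))
  refine tendsto_nhds_unique (hlim.congr' ?_) (tendsto_qFormula N j k hM)
  have hpos : ∀ᶠ q : ℝ in 𝓝[≠] 1, 0 < q := nhdsWithin_le_nhds (Ioi_mem_nhds one_pos)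
  filter_upwards [self_mem_nhdsWithin, hpos] with q hq hq0
  exact skewSpec_eq_qFormula hq0.ne' (by rwa [abs_of_pos hq0]) hj hk hM

end ClassicalLimit

theorem mainTheorem8 :
    -- the explicit value of the principal specialization
    (∀ (q : ℝ), q ≠ 0 → |q| ≠ 1 →
      ∀ (N d j k M : ℕ), 1 ≤ d → j ≤ N → k ≤ N → (d < M ∨ (d ≤ M ∧ j = 0)) →
        skewSpec q N d j k M = qFormula q N d j k M) ∧
    -- its limit as `q → 1` is the explicit value at `(1, …, 1)`
    (∀ (N d j k M : ℕ), 1 ≤ d → j ≤ N → k ≤ N → (d < M ∨ (d ≤ M ∧ j = 0)) →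
        Filter.Tendsto (fun q : ℝ => qFormula q N d j k M) (𝓝[≠] 1)
          (𝓝 (classicalFormula N d j k M)) ∧
        skewSpec 1 N d j k M = classicalFormula N d j k M) ∧
    -- the symbol: Laurent expansion, Toeplitz determinants, biorthogonal polynomials, inverses
    (∀ (q : ℝ), q ≠ 0 → |q| ≠ 1 → ∀ (γ δ : ℕ), 1 ≤ γ → 1 ≤ δ →
      (∀ z : ℂ, z ≠ 0 → thetaSymbol q γ δ z =
        ∑ m ∈ Finset.Icc (-(δ : ℤ)) (γ : ℤ),
          ((qBinom q ((δ : ℤ) + γ) ((δ : ℤ) + m).toNat * q ^ (m * (m + 1) / 2) : ℝ) : ℂ)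
            * z ^ m) ∧
      (∀ N : ℕ, (toeplitz (thetaSymbol q γ δ) N).det =
        ((qBarnes q (N + 1)
          * (qBarnes q (δ + γ + N + 1) / qBarnes q (δ + γ + 1))
          * (qBarnes q (δ + 1) / qBarnes q (δ + N + 1))
          * (qBarnes q (γ + 1) / qBarnes q (γ + N + 1)) : ℝ) : ℂ)) ∧
      (∀ n : ℕ, (biorthP q γ δ n).natDegree = n ∧ (biorthQ q γ δ n).natDegree = n) ∧
      (∀ m n : ℕ,
        circleMean (fun z => (biorthP q γ δ m).eval z * (biorthQ q γ δ n).eval z⁻¹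
          * thetaSymbol q γ δ z) = if m = n then 1 else 0) ∧
      (∀ N : ℕ, IsUnit (toeplitz (thetaSymbol q γ δ) (N + 1)).det ∧
        ∀ a b : Fin (N + 1), (toeplitz (thetaSymbol q γ δ) (N + 1))⁻¹ a b =
          ((∑ r ∈ Finset.Icc (max (a : ℕ) (b : ℕ)) N,
            (-1) ^ ((a : ℕ) + (b : ℕ)) * q ^ (r - (b : ℕ))
            * ((qGamma q (γ + a + 1) * qGamma q (δ + b + 1) * qGamma q (r + 1))
              / (qGamma q ((a : ℕ) + 1) * qGamma q ((b : ℕ) + 1) * qGamma q (δ + γ + r + 1)))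
            * qBinom q ((γ : ℤ) + r - (b : ℕ) - 1) (r - (b : ℕ))
            * qBinom q ((δ : ℤ) + r - (a : ℕ) - 1) (r - (a : ℕ)) : ℝ) : ℂ))) := by
  refine ⟨fun q hq0 hq N d j k M _ hj hk hM => skewSpec_eq_qFormula hq0 hq hj hk (by omega),
    fun N d j k M _ hj hk hM => ⟨tendsto_qFormula N j k (by omega),
      skewSpec_one_eq_classicalFormula hj hk (by omega)⟩,
    fun q hq0 hq γ δ hγ hδ => ⟨fun z hz => thetaSymbol_eq_sum_qBinom hq0 hq γ δ hz, fun N => ?_,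
      fun n => ⟨natDegree_biorthP hq γ hδ n, natDegree_biorthQ hq hγ δ n⟩,
      circleMean_biorthP_mul_biorthQ hq0 hq hγ hδ,
      fun N => ⟨isUnit_det_toeplitz_thetaSymbol hq0 hq γ δ (N + 1),
        inv_toeplitz_thetaSymbol hq0 hq γ δ N⟩⟩⟩
  rw [det_toeplitz_thetaSymbol hq0 hq, det_thetaToeplitz hq0 hq]
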